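/- Let $\mathbb{k}$ be a field, let $S=\mathbb{k}[x_1,\dots,x_n]$ with its fine $\mathbb{Z}^n$-grading and $\mathfrak m=\langle x_1,\dots,x_n\rangle$, and let $I\subseteq S$ be an ideal generated by squarefree monomials. Let $\mathbb{F}$ be the minimal $\mathbb{Z}^n$-graded free resolution of $S/I$, with differential $\partial$ (so $\partial\mathbb{F}\subseteq\mathfrak m\mathbb{F}$). Suppose that $\mathbb{F}$ (identified with $\bigoplus_i\mathbb{F}_i$) admits a multigraded DGA structure, that is, an $S$-linear map $*:\mathbb{F}\otimes_S\mathbb{F}\to\mathbb{F}$ which extends the usual multiplication on $\mathbb{F}_0=S$, respects the homological grading $|\cdot|$ and the $\mathbb{Z}^n$-grading, and satisfies, for homologically homogeneous $a,b,c\in\mathbb{F}$, $$\partial(a*b)=\partial(a)*b+(-1)^{|a|}a*\partial(b),\qquad a*b=(-1)^{|a||b|}\,b*a,\qquad (a*b)*c=a*(b*c).$$ For $0\le i\le\operatorname{pdim}S/I$ put $$t_i:=\max\{j:\beta_{i,j}^S(S/I)\ne 0\},$$ where $\beta_{i,j}^S(S/I)=\dim_{\mathbb{k}}\operatorname{Tor}_i^S(S/I,\mathbb{k})_j$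 are the graded Betti numbers with respect to total degree (this maximum exists). Then $$t_b\le t_a+t_{b-a}\qquad\text{for all integers } a,b \text{ with } 1\le a<b\le\operatorname{pdim}S/I.$$ -/

import Mathlib

open MvPolynomial

universe u v w

/-- An ideal of `k[x₁, …, xₙ]` is a squarefree monomial ideal if it is generated by
squarefree monomials, i.e. by products of distinct variables. -/
def IsSquarefreeMonomialIdeal {k : Type u} [Field k] {n : ℕ}
    (I : Ideal (MvPolynomial (Fin n) k)) : Prop :=
  ∃ T : Set (Finset (Fin n)),
    I = Ideal.span ((fun s : Finset (Fin n) => ∏ l ∈ s, (X l : MvPolynomial (Fin n) k)) '' T)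

/-- The maximal homogeneous ideal `⟨x₁, …, xₙ⟩`. -/
noncomputable def maxHomogeneousIdeal (k : Type u) [Field k] (n : ℕ) : Ideal (MvPolynomial (Fin n) k) :=
  Ideal.span (Set.range X)

/-- A polynomial is homogeneous of multidegree `a ∈ ℤⁿ` (in the fine grading) if every monomial
that occurs in it has exponent vector `a`. -/
def IsMultihomogeneous {k : Type u} [Field k] {n : ℕ} (p : MvPolynomial (Fin n) k)
    (a : Fin n → ℤ) : Prop :=
  ∀ m ∈ p.support, ∀ l, (m l : ℤ) = a l

/-- Consider the free `S`-module with basis `B`, where `e ∈ B` sits in homological degree `hdeg e`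
and has multidegree `mdeg e`. This is its part of homological degree `i`. -/
noncomputable def homologicalPart (k : Type u) [Field k] {n : ℕ} {B : Type v} (hdeg : B → ℕ) (i : ℕ) :
    Submodule (MvPolynomial (Fin n) k) (B →₀ MvPolynomial (Fin n) k) :=
  Finsupp.supported _ _ {e | hdeg e = i}

/-- The `k`-subspace of elements of homological degree `i` and multidegree `a` of the free
`S`-module with bigraded basis `B`: it is spanned by the `x^m e` with `hdeg e = i` and
`mdeg e + m = a`. -/
noncomputable def bigradedPart (k : Type u) [Field k] {n : ℕ} {B : Type v} (hdeg : B → ℕ)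
    (mdeg : B → Fin n → ℤ) (i : ℕ) (a : Fin n → ℤ) :
    Submodule k (B →₀ MvPolynomial (Fin n) k) where
  carrier := {f | ∀ e, ∀ m ∈ (f e).support, hdeg e = i ∧ ∀ l, mdeg e l + (m l : ℤ) = a l}
  zero_mem' := by simp
  add_mem' := by
    classical
    intro f g hf hg e m hm
    rcases Finset.mem_union.1 (MvPolynomial.support_add hm) with h | h
    · exact hf e m h
    · exact hg e m h
  smul_mem' := by
    intro c f hf e m hm
    exact hf e m (MvPolynomial.support_smul hm)

/-- A `ℤⁿ`-graded free resolution `⋯ → F₂ → F₁ → F₀ → S/I → 0` of `S/I` by finitely generated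
graded free `S`-modules, where `S = k[x₁, …, xₙ]`. It is identified with the free module
`⨁ᵢ Fᵢ` on a homogeneous basis `B`. -/
structure MultigradedFreeResolution {k : Type u} [Field k] {n : ℕ}
    (I : Ideal (MvPolynomial (Fin n) k)) where
  /-- the homogeneous basis of `⨁ᵢ Fᵢ` -/
  B : Type v
  /-- the homological degree of the basis elements -/
  hdeg : B → ℕ
  /-- the multidegree of the basis elements -/
  mdeg : B → Fin n → ℤ
  /-- every `Fᵢ` is finitely generated -/
  finite_hdeg : ∀ i, {e | hdeg e = i}.Finite
  /-- the differential -/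
  d : (B →₀ MvPolynomial (Fin n) k) →ₗ[MvPolynomial (Fin n) k] (B →₀ MvPolynomial (Fin n) k)
  d_zero : ∀ f ∈ homologicalPart k hdeg 0, d f = 0
  d_mem : ∀ i a, ∀ f ∈ bigradedPart k hdeg mdeg (i + 1) a, d f ∈ bigradedPart k hdeg mdeg i a
  d_d : ∀ f, d (d f) = 0
  exact_succ : ∀ i, ∀ f ∈ homologicalPart k hdeg (i + 1), d f = 0 →
    ∃ g ∈ homologicalPart k hdeg (i + 2), d g = f
  /-- the augmentation `F₀ → S/I` -/
  ε : homologicalPart k (n := n) hdeg 0 →ₗ[MvPolynomial (Fin n) k] (MvPolynomial (Fin n) k ⧸ I)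
  ε_mem : ∀ a, ∀ f : homologicalPart k (n := n) hdeg 0,
    (f : B →₀ MvPolynomial (Fin n) k) ∈ bigradedPart k hdeg mdeg 0 a →
      ∃ p, IsMultihomogeneous p a ∧ ε f = Ideal.Quotient.mk I p
  ε_surjective : Function.Surjective ε
  exact_zero : ∀ f : homologicalPart k (n := n) hdeg 0,
    ε f = 0 ↔ ∃ g ∈ homologicalPart k hdeg 1, d g = f

namespace MultigradedFreeResolution

variable {k : Type u} [Field k] {n : ℕ} {I : Ideal (MvPolynomial (Fin n) k)}

/-- The total module `⨁ᵢ Fᵢ`. -/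
abbrev Total (F : MultigradedFreeResolution.{u, v} I) : Type (max u v) :=
  F.B →₀ MvPolynomial (Fin n) k

/-- The `S`-submodule `Fᵢ`. -/
noncomputable abbrev hpart (F : MultigradedFreeResolution.{u, v} I) (i : ℕ) :
    Submodule (MvPolynomial (Fin n) k) F.Total :=
  homologicalPart k F.hdeg i

/-- The `k`-subspace of `Fᵢ` of elements of multidegree `a`. -/
noncomputable abbrev part (F : MultigradedFreeResolution.{u, v} I) (i : ℕ) (a : Fin n → ℤ) :
    Submodule k F.Total :=
  bigradedPart k F.hdeg F.mdeg i a

/-- The resolution is minimal if `∂ F ⊆ 𝔪 F`. -/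
def IsMinimal (F : MultigradedFreeResolution.{u, v} I) : Prop :=
  ∀ f : F.Total, F.d f ∈ maxHomogeneousIdeal k n • (⊤ : Submodule (MvPolynomial (Fin n) k) F.Total)

/-- A (multigraded) DGA structure on the resolution `F`, with `F₀ = S`. -/
structure DGAStructure (F : MultigradedFreeResolution.{u, v} I) where
  /-- the multiplication `F ⊗ F → F` as a bilinear map -/
  mul : F.Total →ₗ[MvPolynomial (Fin n) k] F.Total →ₗ[MvPolynomial (Fin n) k] F.Total
  /-- the element that corresponds to `1 ∈ S` under the identification `F₀ = S` -/
  one : F.hpart 0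
  one_mem : (one : F.Total) ∈ F.part 0 0
  ε_one : F.ε one = 1
  eq_smul_one : ∀ f : F.hpart 0, ∃ s : MvPolynomial (Fin n) k, f = s • one
  /-- on `F₀ = S` the product is the product of `S`: by bilinearity,
  `(s • 1) * (t • 1) = (s t) • 1` -/
  one_mul_one : mul one one = one
  leibniz : ∀ i, ∀ f ∈ F.hpart i, ∀ g : F.Total,
    F.d (mul f g) = mul (F.d f) g + (-1 : MvPolynomial (Fin n) k) ^ i • mul f (F.d g)
  /-- homogeneity for the homological grading and for the multigrading -/
  mul_mem : ∀ i j a b, ∀ f ∈ F.part i a, ∀ g ∈ F.part j b, mul f g ∈ F.part (i + j) (a + b)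
  mul_comm : ∀ i j, ∀ f ∈ F.hpart i, ∀ g ∈ F.hpart j,
    mul f g = (-1 : MvPolynomial (Fin n) k) ^ (i * j) • mul g f
  mul_assoc : ∀ f g h : F.Total, mul (mul f g) h = mul f (mul g h)

/-- The underlying module of the complex `G ⊗ k`, where `k = S/𝔪`; as usual, `G ⊗ S/𝔪 = G/𝔪G`. -/
abbrev Residue (G : MultigradedFreeResolution.{u, v} I) : Type (max u v) :=
  G.Total ⧸ (maxHomogeneousIdeal k n • ⊤ : Submodule (MvPolynomial (Fin n) k) G.Total)

/-- The differential of `G ⊗ k`, induced by that of `G`, as a `k`-linear map. -/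
noncomputable def residueD (G : MultigradedFreeResolution.{u, v} I) : G.Residue →ₗ[k] G.Residue :=
  (Submodule.mapQ _ _ G.d
    (Submodule.smul_top_le_comap_smul_top (maxHomogeneousIdeal k n) G.d)).restrictScalars k

/-- The part of `G ⊗ k` in homological degree `i` and multidegree `a`: the image of the
corresponding part of `G`. -/
noncomputable def residuePart (G : MultigradedFreeResolution.{u, v} I) (i : ℕ) (a : Fin n → ℤ) :
    Submodule k G.Residue :=
  (G.part i a).map ((Submodule.mkQ _).restrictScalars k)

/-- The cycles of `G ⊗ k` in homological degree `i` and multidegree `a`. -/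
noncomputable def torCycles (G : MultigradedFreeResolution.{u, v} I) (i : ℕ) (a : Fin n → ℤ) :
    Submodule k G.Residue :=
  G.residuePart i a ⊓ LinearMap.ker G.residueD

/-- The boundaries of `G ⊗ k` in homological degree `i` and multidegree `a`. -/
noncomputable def torBoundaries (G : MultigradedFreeResolution.{u, v} I) (i : ℕ)
    (a : Fin n → ℤ) : Submodule k G.Residue :=
  (G.residuePart (i + 1) a).map G.residueD

/-- `Tor_i(S/I, k)` in multidegree `a`, computed from the free resolution `G` of `S/I`. -/
abbrev Tor (G : MultigradedFreeResolution.{u, v} I) (i : ℕ) (a : Fin n → ℤ) : Type (max u v) :=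
  G.torCycles i a ⧸ (G.torBoundaries i a).submoduleOf (G.torCycles i a)

/-- The multigraded Betti number `β_{i,a}(S/I) = dim_k Tor_i(S/I, k)_a`. -/
noncomputable def multigradedBetti (G : MultigradedFreeResolution.{u, v} I) (i : ℕ)
    (a : Fin n → ℤ) : ℕ :=
  Module.finrank k (G.Tor i a)

/-- The graded Betti number `β_{i,j}(S/I)`: the sum of the `β_{i,a}(S/I)` over all `a` of total
degree `j`. -/
noncomputable def gradedBetti (G : MultigradedFreeResolution.{u, v} I) (i : ℕ) (j : ℤ) : ℕ :=
  ∑ᶠ a : {a : Fin n → ℤ // ∑ l, a l = j}, G.multigradedBetti i a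

/-- The maximal shift `t_i = max {j : β_{i,j}(S/I) ≠ 0}`. -/
noncomputable def maxShift (G : MultigradedFreeResolution.{u, v} I) (i : ℕ) : ℤ :=
  sSup {j : ℤ | G.gradedBetti i j ≠ 0}

end MultigradedFreeResolution

/-! Comparing resolutions shows that the multidegrees `a` with `β_{i,a} ≠ 0` are those of the basis
elements of `Fᵢ` in the minimal resolution, whichever `G` computes Tor
(`multigradedBetti_ne_zero_iff`). So it suffices to find, for a basis element `e` of homological
degree `a + c`, basis elements `e₁`, `e₂` of degrees `a`, `c` with `mdeg e ≤ mdeg e₁ + mdeg e₂`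
(`exists_mdeg_le_add`). They exist once `e`, up to a boundary, has a nonzero multiple in `F_a *
F_c`: boundaries lie in `𝔪F`, so the coefficient at `e` stays nonzero, and some product `e₁ * e₂`
must involve `e`.

That decomposition (`exists_basisElem_sub_d_mem_satProd`) is by induction on `a`. Choose `e₁` of
degree 1 with `mdeg e₁ ≤ mdeg e` and `∂e₁ = c x^m`. For `g` of multidegree `mdeg e`, the Leibniz
rule gives `c x^m g = ∂(e₁ * g) + e₁ * ∂g`. All basis multidegrees are squarefree
(`mdeg_squarefree`), so `e₁ * g` is divisible by `x^m`; hence a multiple of `g`, up to a boundary of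
the same multidegree, equals `e₁ * ∂g` (`exists_smul_sub_d_eq_mul`). By induction `∂e` lies, up to
some `∂h`, in the saturation of `F_{a-1} * F_c`. Taking `g = e - h`, associativity moves `e₁ * ∂g`
into that of `F_a * F_c`. The correction `h` involves only basis elements of smaller total degree,
so a second induction absorbs it. -/

section Graded

/-! ### Multihomogeneous polynomials and bigraded components of free modules. -/

variable {k : Type u} [Field k] {n : ℕ}

theorem mem_maxHomogeneousIdeal_iff {p : MvPolynomial (Fin n) k} :
    p ∈ maxHomogeneousIdeal k n ↔ coeff 0 p = 0 := by
  have h := MvPolynomial.mem_pow_idealOfVars_iff' (σ := Fin n) (R := k) 1 p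
  rw [pow_one] at h
  refine Iff.trans h ⟨fun H => H 0 (by simp), fun H x hx => ?_⟩
  have : x = 0 := by
    rw [Nat.lt_one_iff] at hx
    exact (Finsupp.degree_eq_zero_iff x).1 hx
  rw [this, H]

/-- An exponent vector with integer entries, as an exponent vector (negative entries become `0`). -/
noncomputable def expOf (a : Fin n → ℤ) : Fin n →₀ ℕ :=
  Finsupp.equivFunOnFinite.symm fun l => (a l).toNat

theorem expOf_eq_of_forall {a : Fin n → ℤ} {m : Fin n →₀ ℕ} (h : ∀ l, (m l : ℤ) = a l) :
    expOf a = m := by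
  ext l
  simp [expOf, ← h l]

theorem expOf_apply {a : Fin n → ℤ} {l : Fin n} (h : 0 ≤ a l) : ((expOf a l : ℕ) : ℤ) = a l := by
  simp [expOf, h]

open Classical in
/-- The component of multidegree `a` of a polynomial. -/
noncomputable def multiComponent (k : Type u) [Field k] {n : ℕ} (a : Fin n → ℤ) :
    MvPolynomial (Fin n) k →ₗ[k] MvPolynomial (Fin n) k :=
  -- `expOf` truncates negative entries to `0`; without the test such a degree would pick up the
  -- coefficient of a monomial of another degree.
  if ∀ l, 0 ≤ a l then (monomial (expOf a)) ∘ₗ (lcoeff k (expOf a)) else 0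

open Classical in
theorem coeff_multiComponent (a : Fin n → ℤ) (p : MvPolynomial (Fin n) k) (m : Fin n →₀ ℕ) :
    coeff m (multiComponent k a p) = if ∀ l, (m l : ℤ) = a l then coeff m p else 0 := by
  unfold multiComponent
  by_cases h : ∀ l, 0 ≤ a l
  · rw [if_pos h]
    simp only [LinearMap.comp_apply, coeff_monomial]
    by_cases h' : ∀ l, (m l : ℤ) = a l
    · rw [if_pos (expOf_eq_of_forall h'), if_pos h', expOf_eq_of_forall h']
      rfl
    · rw [if_neg h', if_neg]
      rintro rfl
      exact h' fun l => expOf_apply (h l)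
  · rw [if_neg h, if_neg]
    · simp
    · intro h'
      exact h fun l => by rw [← h' l]; positivity

theorem IsMultihomogeneous.eq_monomial {p : MvPolynomial (Fin n) k} {a : Fin n → ℤ}
    (h : IsMultihomogeneous p a) : p = monomial (expOf a) (coeff (expOf a) p) := by
  classical
  ext m
  rw [coeff_monomial]
  split_ifs with h'
  · rw [h']
  · by_contra h0
    exact h' (expOf_eq_of_forall (h m (mem_support_iff.2 h0)))

theorem IsMultihomogeneous.expOf_apply {p : MvPolynomial (Fin n) k} {a : Fin n → ℤ}
    (h : IsMultihomogeneous p a) (hp : p ≠ 0) (l : Fin n) : ((expOf a l : ℕ) : ℤ) = a l := by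
  obtain ⟨m, hm⟩ := (ne_zero_iff).1 hp
  have := h m (mem_support_iff.2 hm)
  rw [expOf_eq_of_forall this, this]

theorem isMultihomogeneous_monomial {a : Fin n → ℤ} {m : Fin n →₀ ℕ} (c : k)
    (h : ∀ l, (m l : ℤ) = a l) : IsMultihomogeneous (monomial m c) a := by
  intro m' hm' l
  have := support_monomial_subset hm'
  rw [Finset.mem_singleton] at this
  rw [this, h]

theorem isMultihomogeneous_multiComponent (a : Fin n → ℤ) (p : MvPolynomial (Fin n) k) :
    IsMultihomogeneous (multiComponent k a p) a := by
  classical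
  intro m hm
  rw [mem_support_iff, coeff_multiComponent] at hm
  by_contra h
  exact hm (if_neg h)

theorem multiComponent_eq_self {a : Fin n → ℤ} {p : MvPolynomial (Fin n) k}
    (h : IsMultihomogeneous p a) : multiComponent k a p = p := by
  classical
  ext m
  rw [coeff_multiComponent]
  split_ifs with h'
  · rfl
  · by_contra h0
    exact h' (h m (mem_support_iff.2 (Ne.symm h0)))

theorem multiComponent_eq_zero {a b : Fin n → ℤ} {p : MvPolynomial (Fin n) k}
    (h : IsMultihomogeneous p b) (hab : a ≠ b) : multiComponent k a p = 0 := by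
  classical
  ext m
  rw [coeff_multiComponent, coeff_zero]
  split_ifs with h'
  · by_contra h0
    refine hab (funext fun l => ?_)
    rw [← h' l, h m (mem_support_iff.2 h0)]
  · rfl

variable {B : Type v} {hdeg : B → ℕ} {mdeg : B → Fin n → ℤ}

theorem mem_maxHomogeneousIdeal_smul_top_iff {f : B →₀ MvPolynomial (Fin n) k} :
    f ∈ (maxHomogeneousIdeal k n • ⊤ : Submodule (MvPolynomial (Fin n) k) _) ↔
      ∀ e, coeff 0 (f e) = 0 := by
  constructor
  · intro h e
    rw [← mem_maxHomogeneousIdeal_iff]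
    refine Submodule.smul_induction_on h ?_ ?_
    · intro r hr x _
      exact Ideal.mul_mem_right _ _ hr
    · intro x y hx hy
      exact Ideal.add_mem _ hx hy
  · intro h
    rw [← Finsupp.sum_single f]
    refine Submodule.sum_mem _ fun e _ => ?_
    rw [← mul_one (f e), ← smul_eq_mul, ← Finsupp.smul_single]
    exact Submodule.smul_mem_smul (mem_maxHomogeneousIdeal_iff.2 (h e)) trivial

theorem mem_homologicalPart_iff {i : ℕ} {f : B →₀ MvPolynomial (Fin n) k} :
    f ∈ homologicalPart k hdeg i ↔ ∀ e, f e ≠ 0 → hdeg e = i := by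
  unfold homologicalPart
  rw [Finsupp.mem_supported]
  exact ⟨fun h e he => h (Finsupp.mem_support_iff.2 he),
    fun h e he => h e (Finsupp.mem_support_iff.1 he)⟩

theorem mem_bigradedPart_iff {i : ℕ} {a : Fin n → ℤ} {f : B →₀ MvPolynomial (Fin n) k} :
    f ∈ bigradedPart k hdeg mdeg i a ↔
      f ∈ homologicalPart k hdeg i ∧ ∀ e, IsMultihomogeneous (f e) (a - mdeg e) := by
  rw [mem_homologicalPart_iff]
  constructor
  · intro h
    refine ⟨fun e he => ?_, fun e m hm l => ?_⟩
    · obtain ⟨m, hm⟩ := (ne_zero_iff).1 he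
      exact (h e m (mem_support_iff.2 hm)).1
    · have := (h e m hm).2 l
      rw [Pi.sub_apply]
      linarith
  · rintro ⟨h1, h2⟩ e m hm
    refine ⟨h1 e ?_, fun l => ?_⟩
    · rintro h
      rw [h] at hm
      simp at hm
    · rw [h2 e m hm l, Pi.sub_apply]
      ring

theorem bigradedPart_le {i : ℕ} {a : Fin n → ℤ} {f : B →₀ MvPolynomial (Fin n) k}
    (h : f ∈ bigradedPart k hdeg mdeg i a) : f ∈ homologicalPart k hdeg i :=
  (mem_bigradedPart_iff.1 h).1

theorem single_one_mem_bigradedPart (e : B) :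
    Finsupp.single e (1 : MvPolynomial (Fin n) k) ∈ bigradedPart k hdeg mdeg (hdeg e) (mdeg e) := by
  classical
  intro e' m hm
  rw [Finsupp.single_apply] at hm
  split_ifs at hm with h
  · subst h
    have : m = 0 := by
      by_contra h0
      rw [mem_support_iff, coeff_one, if_neg (Ne.symm h0)] at hm
      exact hm rfl
    simp [this]
  · simp at hm

theorem smul_mem_bigradedPart {i : ℕ} {a c : Fin n → ℤ} {p : MvPolynomial (Fin n) k}
    {f : B →₀ MvPolynomial (Fin n) k} (hp : IsMultihomogeneous p c)
    (hf : f ∈ bigradedPart k hdeg mdeg i a) : p • f ∈ bigradedPart k hdeg mdeg i (c + a) := by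
  classical
  intro e m hm
  rw [Finsupp.smul_apply, smul_eq_mul] at hm
  obtain ⟨x, hx, y, hy, rfl⟩ := Finset.mem_add.1 (support_mul _ _ hm)
  refine ⟨(hf e y hy).1, fun l => ?_⟩
  have h1 := (hf e y hy).2 l
  have h2 := hp x hx l
  rw [Finsupp.add_apply, Pi.add_apply]
  push_cast
  linarith

theorem smul_mem_bigradedPart' {i : ℕ} {a b : Fin n → ℤ} {p : MvPolynomial (Fin n) k}
    {f : B →₀ MvPolynomial (Fin n) k} (hp : IsMultihomogeneous p (b - a))
    (hf : f ∈ bigradedPart k hdeg mdeg i a) : p • f ∈ bigradedPart k hdeg mdeg i b := by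
  have := smul_mem_bigradedPart hp hf
  rwa [sub_add_cancel] at this

open Classical in
/-- The projection onto the part of homological degree `i` and multidegree `a`. -/
noncomputable def bigradedProj (k : Type u) [Field k] {n : ℕ} {B : Type v} (hdeg : B → ℕ)
    (mdeg : B → Fin n → ℤ) (i : ℕ) (a : Fin n → ℤ) :
    (B →₀ MvPolynomial (Fin n) k) →ₗ[k] (B →₀ MvPolynomial (Fin n) k) :=
  Finsupp.lsum k fun e =>
    if hdeg e = i then Finsupp.lsingle e ∘ₗ multiComponent k (a - mdeg e) else 0

open Classical in
theorem bigradedProj_apply (i : ℕ) (a : Fin n → ℤ) (f : B →₀ MvPolynomial (Fin n) k) (e : B) :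
    bigradedProj k hdeg mdeg i a f e =
      if hdeg e = i then multiComponent k (a - mdeg e) (f e) else 0 := by
  induction f using Finsupp.induction_linear with
  | zero => simp
  | add f g hf hg =>
    rw [map_add, Finsupp.add_apply, hf, hg, Finsupp.add_apply, map_add]
    split_ifs <;> simp
  | single e' p =>
    unfold bigradedProj
    rw [Finsupp.lsum_single]
    by_cases hee : e' = e
    · subst hee
      split_ifs <;> simp
    · rw [Finsupp.single_eq_of_ne' hee, map_zero, ite_self]
      split_ifs
      · simp [Finsupp.single_eq_of_ne' hee]
      · simp

theorem bigradedProj_mem (i : ℕ) (a : Fin n → ℤ) (f : B →₀ MvPolynomial (Fin n) k) :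
    bigradedProj k hdeg mdeg i a f ∈ bigradedPart k hdeg mdeg i a := by
  classical
  rw [mem_bigradedPart_iff, mem_homologicalPart_iff]
  refine ⟨fun e he => ?_, fun e => ?_⟩
  · rw [bigradedProj_apply] at he
    by_contra h
    exact he (if_neg h)
  · rw [bigradedProj_apply]
    split_ifs
    · exact isMultihomogeneous_multiComponent _ _
    · intro m hm
      simp at hm

theorem bigradedProj_eq_self {i : ℕ} {a : Fin n → ℤ} {f : B →₀ MvPolynomial (Fin n) k}
    (h : f ∈ bigradedPart k hdeg mdeg i a) : bigradedProj k hdeg mdeg i a f = f := by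
  classical
  rw [mem_bigradedPart_iff, mem_homologicalPart_iff] at h
  ext1 e
  rw [bigradedProj_apply]
  split_ifs with h'
  · exact multiComponent_eq_self (h.2 e)
  · by_contra h0
    exact h' (h.1 e (Ne.symm h0))

theorem bigradedProj_eq_zero {i j : ℕ} {a b : Fin n → ℤ} {f : B →₀ MvPolynomial (Fin n) k}
    (h : f ∈ bigradedPart k hdeg mdeg j b) (hij : ¬(i = j ∧ a = b)) :
    bigradedProj k hdeg mdeg i a f = 0 := by
  classical
  rw [mem_bigradedPart_iff, mem_homologicalPart_iff] at h
  ext1 e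
  rw [bigradedProj_apply, Finsupp.zero_apply]
  split_ifs with h'
  · by_cases h0 : f e = 0
    · rw [h0, map_zero]
    · refine multiComponent_eq_zero (h.2 e) fun hab => hij ⟨?_, sub_left_injective hab⟩
      rw [← h', h.1 e h0]
  · rfl

theorem single_monomial_mem_bigradedPart (e : B) (m : Fin n →₀ ℕ) (c : k) :
    Finsupp.single e (monomial m c) ∈
      bigradedPart k hdeg mdeg (hdeg e) ((fun l => (m l : ℤ)) + mdeg e) := by
  have h := smul_mem_bigradedPart (isMultihomogeneous_monomial (a := fun l => (m l : ℤ)) c fun l => rfl)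
    (single_one_mem_bigradedPart (k := k) (hdeg := hdeg) (mdeg := mdeg) e)
  rwa [Finsupp.smul_single, smul_eq_mul, mul_one] at h

/-- `k`-linear maps on a free module agree if they agree on the terms `x^m e`. -/
theorem linearMap_ext_monomial {M : Type*} [AddCommGroup M] [Module k M]
    {f g : (B →₀ MvPolynomial (Fin n) k) →ₗ[k] M}
    (h : ∀ e m c, f (Finsupp.single e (monomial m c)) = g (Finsupp.single e (monomial m c))) :
    f = g := by
  refine Finsupp.lhom_ext' fun e => ?_
  refine LinearMap.ext fun p => ?_
  induction p using MvPolynomial.induction_on' with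
  | monomial m c => exact h e m c
  | add p q hp hq => rw [map_add, map_add, hp, hq]

theorem homologicalPart_le {i : ℕ}
    {P : Submodule (MvPolynomial (Fin n) k) (B →₀ MvPolynomial (Fin n) k)}
    (h : ∀ e, hdeg e = i → Finsupp.single e 1 ∈ P) : homologicalPart k hdeg i ≤ P := by
  unfold homologicalPart
  rw [Finsupp.supported_eq_span_single, Submodule.span_le]
  rintro _ ⟨e, he, rfl⟩
  exact h e he

theorem eq_sum_smul_single (f : B →₀ MvPolynomial (Fin n) k) :
    f = ∑ e ∈ f.support, f e • Finsupp.single e (1 : MvPolynomial (Fin n) k) := by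
  conv_lhs => rw [← Finsupp.sum_single f]
  refine Finset.sum_congr rfl fun e _ => ?_
  rw [Finsupp.smul_single, smul_eq_mul, mul_one]

end Graded

/-! ### Squarefree monomial ideals. -/

namespace IsSquarefreeMonomialIdeal

variable {k : Type u} [Field k] {n : ℕ} {I : Ideal (MvPolynomial (Fin n) k)}

/-- A squarefree generator divides `x^m` exactly when its variables all occur in `x^m`, so
membership depends only on which variables occur in each monomial. -/
theorem exists_mem_iff (hI : IsSquarefreeMonomialIdeal I) :
    ∃ T : Set (Finset (Fin n)), ∀ p : MvPolynomial (Fin n) k, p ∈ I ↔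
      ∀ m ∈ p.support, ∃ s ∈ T, ∀ l ∈ s, 1 ≤ m l := by
  classical
  obtain ⟨T, rfl⟩ := hI
  refine ⟨T, fun p => ?_⟩
  have h1 : ∀ s : Finset (Fin n), (∏ l ∈ s, (X l : MvPolynomial (Fin n) k)) =
      monomial (∑ l ∈ s, Finsupp.single l 1) 1 := fun s => by
    rw [monomial_sum_one]
    rfl
  have h2 : ∀ (s : Finset (Fin n)) (l : Fin n),
      (∑ l ∈ s, Finsupp.single l 1 : Fin n →₀ ℕ) l = if l ∈ s then 1 else 0 := fun s l => by
    rw [Finsupp.finsetSum_apply]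
    simp [Finsupp.single_apply]
  have h3 : (fun s : Finset (Fin n) => ∏ l ∈ s, (X l : MvPolynomial (Fin n) k)) '' T =
      (fun m => monomial m (1 : k)) '' ((fun s => ∑ l ∈ s, Finsupp.single l 1) '' T) := by
    rw [Set.image_image]
    exact Set.image_congr fun s _ => h1 s
  rw [h3, mem_ideal_span_monomial_image]
  refine forall₂_congr fun m _ => ?_
  rw [Set.exists_mem_image]
  refine exists_congr fun s => and_congr_right fun _ => ?_
  rw [Finsupp.le_def]
  refine forall_congr' fun l => ?_
  rw [h2]
  by_cases h : l ∈ s <;> simp [h]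

theorem multiComponent_mem (hI : IsSquarefreeMonomialIdeal I) (a : Fin n → ℤ)
    {p : MvPolynomial (Fin n) k} (hp : p ∈ I) : multiComponent k a p ∈ I := by
  classical
  obtain ⟨T, hT⟩ := hI.exists_mem_iff
  rw [hT] at hp ⊢
  intro m hm
  refine hp m ?_
  rw [mem_support_iff, coeff_multiComponent] at hm
  rw [mem_support_iff]
  intro h
  rw [h, ite_self] at hm
  exact hm rfl

/-- If `a l ≥ 1` then multiplication by `X l` is injective on `(S/I)_a`. -/
theorem mem_of_X_mul_mem (hI : IsSquarefreeMonomialIdeal I) {a : Fin n → ℤ}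
    {p : MvPolynomial (Fin n) k} (hp : IsMultihomogeneous p a) {l : Fin n} (hl : 1 ≤ a l)
    (h : X l * p ∈ I) : p ∈ I := by
  classical
  obtain ⟨T, hT⟩ := hI.exists_mem_iff
  rw [hT] at h ⊢
  intro m hm
  obtain ⟨s, hs, H⟩ := h (Finsupp.single l 1 + m) (by
    rw [mem_support_iff, coeff_X_mul]
    exact mem_support_iff.1 hm)
  refine ⟨s, hs, fun l' hl' => ?_⟩
  -- Since `m l = a l ≥ 1`, the variable `X l` already occurs in `x^m`, and multiplying by it
  -- creates no new divisibility by generators.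
  by_cases hll : l = l'
  · subst hll
    have := hp m hm l
    omega
  · have := H l' hl'
    rwa [Finsupp.add_apply, Finsupp.single_eq_of_ne' hll, zero_add] at this

end IsSquarefreeMonomialIdeal

/-! ### Exactness and augmentation in a fixed multidegree. -/

namespace MultigradedFreeResolution

variable {k : Type u} [Field k] {n : ℕ} {I : Ideal (MvPolynomial (Fin n) k)}

/-- The basis element `e`, as an element of the resolution. -/
noncomputable abbrev basisElem (F : MultigradedFreeResolution.{u, v} I) (e : F.B) : F.Total :=
  Finsupp.single e 1

theorem basisElem_mem_part (F : MultigradedFreeResolution.{u, v} I) (e : F.B) :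
    F.basisElem e ∈ F.part (F.hdeg e) (F.mdeg e) :=
  single_one_mem_bigradedPart e

theorem basisElem_mem_hpart (F : MultigradedFreeResolution.{u, v} I) (e : F.B) :
    F.basisElem e ∈ F.hpart (F.hdeg e) :=
  bigradedPart_le (F.basisElem_mem_part e)

theorem d_mem_hpart (F : MultigradedFreeResolution.{u, v} I) {i : ℕ} {f : F.Total}
    (hf : f ∈ F.hpart (i + 1)) : F.d f ∈ F.hpart i := by
  have : F.hpart (i + 1) ≤ (F.hpart i).comap F.d := by
    refine homologicalPart_le fun e he => ?_
    have h := F.basisElem_mem_part e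
    rw [he] at h
    exact bigradedPart_le (F.d_mem _ _ _ h)
  exact this hf

/-- The projection of a resolution onto its part of homological degree `i` and multidegree `a`. -/
noncomputable abbrev proj (F : MultigradedFreeResolution.{u, v} I) (i : ℕ) (a : Fin n → ℤ) :
    F.Total →ₗ[k] F.Total :=
  bigradedProj k F.hdeg F.mdeg i a

/-- Projecting a preimage under `∂` to a bidegree gives a homogeneous preimage; this turns the
exactness axioms into exactness in each multidegree. -/
theorem d_proj (F : MultigradedFreeResolution.{u, v} I) (i : ℕ) (a : Fin n → ℤ) (f : F.Total) :
    F.d (F.proj (i + 1) a f) = F.proj i a (F.d f) := by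
  suffices H : (F.d.restrictScalars k) ∘ₗ F.proj (i + 1) a = F.proj i a ∘ₗ F.d.restrictScalars k from
    LinearMap.congr_fun H f
  refine linearMap_ext_monomial fun e m c => ?_
  simp only [LinearMap.comp_apply, LinearMap.coe_restrictScalars]
  have h := single_monomial_mem_bigradedPart (k := k) (hdeg := F.hdeg) (mdeg := F.mdeg) e m c
  generalize (fun l => (m l : ℤ)) + F.mdeg e = b at h
  generalize Finsupp.single e (monomial m c) = x at h
  obtain hj | ⟨j, hj⟩ : F.hdeg e = 0 ∨ ∃ j, F.hdeg e = j + 1 :=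
    (Nat.eq_zero_or_eq_succ_pred _).imp_right fun h => ⟨_, h⟩
  · rw [hj] at h
    rw [bigradedProj_eq_zero h (by simp), F.d_zero x (bigradedPart_le h), map_zero, map_zero]
  · rw [hj] at h
    by_cases H : i = j ∧ a = b
    · obtain ⟨rfl, rfl⟩ := H
      rw [bigradedProj_eq_self h, bigradedProj_eq_self (F.d_mem _ _ _ h)]
    · rw [bigradedProj_eq_zero (F.d_mem _ _ _ h) H, bigradedProj_eq_zero h, map_zero]
      rintro ⟨h1, h2⟩
      exact H ⟨Nat.succ_injective h1, h2⟩

theorem exists_mem_part_d_eq (F : MultigradedFreeResolution.{u, v} I) {i : ℕ} {a : Fin n → ℤ}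
    {f : F.Total} (hf : f ∈ F.part i a) (h : ∃ g, F.d g = f) :
    ∃ g ∈ F.part (i + 1) a, F.d g = f := by
  obtain ⟨g, rfl⟩ := h
  exact ⟨F.proj (i + 1) a g, bigradedProj_mem _ _ _, by rw [d_proj, bigradedProj_eq_self hf]⟩

theorem exists_mem_part_of_d_eq_zero (F : MultigradedFreeResolution.{u, v} I) {i : ℕ}
    {a : Fin n → ℤ} {f : F.Total} (hf : f ∈ F.part (i + 1) a) (h : F.d f = 0) :
    ∃ g ∈ F.part (i + 2) a, F.d g = f := by
  obtain ⟨g, -, hg⟩ := F.exact_succ i f (bigradedPart_le hf) h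
  exact F.exists_mem_part_d_eq hf ⟨g, hg⟩

/-- The projection of `⨁ᵢ Fᵢ` onto `F₀`. -/
noncomputable def toHpartZero (F : MultigradedFreeResolution.{u, v} I) :
    F.Total →ₗ[MvPolynomial (Fin n) k] F.hpart 0 :=
  Finsupp.restrictDom (MvPolynomial (Fin n) k) (MvPolynomial (Fin n) k) {e | F.hdeg e = 0}

theorem toHpartZero_of_mem (F : MultigradedFreeResolution.{u, v} I) {f : F.Total}
    (hf : f ∈ F.hpart 0) : F.toHpartZero f = ⟨f, hf⟩ := by
  refine Subtype.ext ?_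
  exact (Finsupp.filter_eq_self_iff _ _).2 (mem_homologicalPart_iff.1 hf)

theorem toHpartZero_eq_zero (F : MultigradedFreeResolution.{u, v} I) {i : ℕ} {f : F.Total}
    (hf : f ∈ F.hpart i) (hi : i ≠ 0) : F.toHpartZero f = 0 := by
  refine Subtype.ext ?_
  refine (Finsupp.filter_eq_zero_iff _ _).2 fun e he => ?_
  by_contra h
  exact hi ((mem_homologicalPart_iff.1 hf e h).symm.trans he)

/-- The augmentation `ε`, extended by zero to `⨁ᵢ Fᵢ`. -/
noncomputable def aug (F : MultigradedFreeResolution.{u, v} I) :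
    F.Total →ₗ[MvPolynomial (Fin n) k] (MvPolynomial (Fin n) k ⧸ I) :=
  F.ε ∘ₗ F.toHpartZero

theorem aug_of_mem (F : MultigradedFreeResolution.{u, v} I) {f : F.Total} (hf : f ∈ F.hpart 0) :
    F.aug f = F.ε ⟨f, hf⟩ := by
  rw [aug, LinearMap.comp_apply, F.toHpartZero_of_mem hf]

theorem aug_d (F : MultigradedFreeResolution.{u, v} I) {f : F.Total} (hf : f ∈ F.hpart 1) :
    F.aug (F.d f) = 0 := by
  rw [F.aug_of_mem (F.d_mem_hpart hf)]
  exact (F.exact_zero _).2 ⟨f, hf, rfl⟩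

theorem exists_mem_part_of_aug_eq_zero (F : MultigradedFreeResolution.{u, v} I)
    {a : Fin n → ℤ} {f : F.Total} (hf : f ∈ F.part 0 a) (h : F.aug f = 0) :
    ∃ g ∈ F.part 1 a, F.d g = f := by
  rw [F.aug_of_mem (bigradedPart_le hf)] at h
  obtain ⟨g, -, hg⟩ := (F.exact_zero _).1 h
  exact F.exists_mem_part_d_eq hf ⟨g, hg⟩

/-- The projection of `S/I` onto its part of multidegree `a`. -/
noncomputable def quotientComponent (hI : IsSquarefreeMonomialIdeal I) (a : Fin n → ℤ) :
    (MvPolynomial (Fin n) k ⧸ I) →ₗ[k] (MvPolynomial (Fin n) k ⧸ I) :=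
  Submodule.mapQ (I.restrictScalars k) (I.restrictScalars k) (multiComponent k a)
    fun _ hp => hI.multiComponent_mem a hp

theorem quotientComponent_mk (hI : IsSquarefreeMonomialIdeal I) (a : Fin n → ℤ)
    (p : MvPolynomial (Fin n) k) : quotientComponent hI a (Ideal.Quotient.mk I p) =
      Ideal.Quotient.mk I (multiComponent k a p) :=
  rfl

theorem ε_proj (F : MultigradedFreeResolution.{u, v} I) (hI : IsSquarefreeMonomialIdeal I)
    (a : Fin n → ℤ) (f : F.hpart 0) :
    F.ε ⟨F.proj 0 a f, bigradedPart_le (bigradedProj_mem 0 a f.1)⟩ =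
      quotientComponent hI a (F.ε f) := by
  -- Both sides are extended by zero from `F₀` to the total module, where `linearMap_ext_monomial`
  -- applies.
  let f1 : F.Total →ₗ[k] MvPolynomial (Fin n) k ⧸ I :=
    F.ε.restrictScalars k ∘ₗ (F.proj 0 a).codRestrict ((F.hpart 0).restrictScalars k)
      (fun f => bigradedPart_le (bigradedProj_mem 0 a f))
  let r : F.Total →ₗ[k] F.hpart 0 := F.toHpartZero.restrictScalars k
  have hr : ∀ x (hx : x ∈ F.hpart 0), r x = ⟨x, hx⟩ := fun _ => F.toHpartZero_of_mem
  have hr0 : ∀ i x, x ∈ F.hpart i → i ≠ 0 → r x = 0 := fun _ _ => F.toHpartZero_eq_zero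
  suffices H : f1 = quotientComponent hI a ∘ₗ F.ε.restrictScalars k ∘ₗ r by
    have := LinearMap.congr_fun H f.1
    simp only [LinearMap.comp_apply, hr f.1 f.2] at this
    exact this
  refine linearMap_ext_monomial fun e m c => ?_
  have h := single_monomial_mem_bigradedPart (k := k) (hdeg := F.hdeg) (mdeg := F.mdeg) e m c
  generalize (fun l => (m l : ℤ)) + F.mdeg e = b at h
  generalize Finsupp.single e (monomial m c) = x at h
  have hf1 : ∀ y (hy : y ∈ F.hpart 0), F.proj 0 a x = y → f1 x = F.ε ⟨y, hy⟩ := by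
    rintro y hy rfl
    rfl
  have e0 : F.ε ⟨0, zero_mem _⟩ = 0 := map_zero F.ε
  simp only [LinearMap.comp_apply, LinearMap.coe_restrictScalars]
  by_cases hj : F.hdeg e = 0
  · rw [hj] at h
    have hx := bigradedPart_le h
    rw [hr x hx]
    obtain ⟨p, hp, hp'⟩ := F.ε_mem b ⟨x, hx⟩ h
    rw [hp', quotientComponent_mk]
    by_cases hab : a = b
    · subst hab
      rw [hf1 x hx (bigradedProj_eq_self h), hp', multiComponent_eq_self hp]
    · rw [hf1 0 (zero_mem _) (bigradedProj_eq_zero h (by tauto)), e0,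
        multiComponent_eq_zero hp hab, map_zero]
  · rw [hr0 _ _ (bigradedPart_le h) hj, map_zero, map_zero,
      hf1 0 (zero_mem _) (bigradedProj_eq_zero h fun h => hj h.1.symm), e0]

theorem exists_aug_eq (F : MultigradedFreeResolution.{u, v} I) (hI : IsSquarefreeMonomialIdeal I)
    {a : Fin n → ℤ} {p : MvPolynomial (Fin n) k} (hp : IsMultihomogeneous p a) :
    ∃ f ∈ F.part 0 a, F.aug f = Ideal.Quotient.mk I p := by
  obtain ⟨f, hf⟩ := F.ε_surjective (Ideal.Quotient.mk I p)
  exact ⟨_, bigradedProj_mem 0 a f.1, by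
    rw [F.aug_of_mem (bigradedPart_le (bigradedProj_mem 0 a f.1)), F.ε_proj hI, hf,
      quotientComponent_mk, multiComponent_eq_self hp]⟩

/-! ### Comparison of resolutions: homogeneous chain maps and homotopies. -/

/-- A linear map between resolutions is homogeneous of homological degree `j - i` on the elements
of degree `i` if it is so on basis elements. -/
theorem map_mem_part {F : MultigradedFreeResolution.{u, v} I}
    {G : MultigradedFreeResolution.{u, w} I} {i j : ℕ}
    {g : F.Total →ₗ[MvPolynomial (Fin n) k] G.Total}
    (h : ∀ e, F.hdeg e = i → g (F.basisElem e) ∈ G.part j (F.mdeg e)) {a : Fin n → ℤ} {f : F.Total}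
    (hf : f ∈ F.part i a) : g f ∈ G.part j a := by
  rw [mem_bigradedPart_iff, mem_homologicalPart_iff] at hf
  rw [eq_sum_smul_single f, map_sum]
  refine Submodule.sum_mem _ fun e he => ?_
  rw [map_smul]
  exact smul_mem_bigradedPart' (hf.2 e) (h e (hf.1 e (Finsupp.mem_support_iff.1 he)))

/-- A family of homogeneous elements of `G` extends to a homogeneous linear map. -/
theorem exists_map_of_basis (F : MultigradedFreeResolution.{u, v} I)
    (G : MultigradedFreeResolution.{u, w} I) (i j : ℕ) (p : F.B → G.Total → Prop)
    (h : ∀ e, F.hdeg e = i → ∃ y ∈ G.part j (F.mdeg e), p e y) :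
    ∃ g : F.Total →ₗ[MvPolynomial (Fin n) k] G.Total,
      (∀ a, ∀ f ∈ F.part i a, g f ∈ G.part j a) ∧
      ∀ e, F.hdeg e = i → p e (g (F.basisElem e)) := by
  classical
  choose! y hy hp using h
  have hg : ∀ e, Finsupp.linearCombination (MvPolynomial (Fin n) k) y (F.basisElem e) = y e :=
    fun e => by rw [Finsupp.linearCombination_single, one_smul]
  refine ⟨Finsupp.linearCombination _ y, fun a f hf => map_mem_part (fun e he => ?_) hf,
    fun e he => ?_⟩
  · rw [hg]
    exact hy e he
  · rw [hg]
    exact hp e he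

/-- Inductive construction of a homogeneous map `h` with `∂ h = t + c • h ∂`: this covers both
chain maps and chain homotopies. -/
theorem exists_lift (F : MultigradedFreeResolution.{u, v} I)
    (G : MultigradedFreeResolution.{u, w} I) (r : ℕ) (c : MvPolynomial (Fin n) k)
    (hc : IsMultihomogeneous c 0)
    (t h₀ : F.Total →ₗ[MvPolynomial (Fin n) k] G.Total)
    (h₀_mem : ∀ a, ∀ f ∈ F.part 0 a, h₀ f ∈ G.part r a)
    (t_mem : ∀ i a, ∀ f ∈ F.part (i + 1) a, t f ∈ G.part (i + r) a)
    (t_d : ∀ f, G.d (t f) + c • t (F.d f) = 0)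
    (h₁ : ∀ e, F.hdeg e = 1 →
      ∃ y, G.d y = t (F.basisElem e) + c • h₀ (F.d (F.basisElem e))) :
    ∃ h : F.Total →ₗ[MvPolynomial (Fin n) k] G.Total,
      (∀ f ∈ F.hpart 0, h f = h₀ f) ∧
      (∀ i a, ∀ f ∈ F.part i a, h f ∈ G.part (i + r) a) ∧
      ∀ i, ∀ f ∈ F.hpart (i + 1), G.d (h f) = t f + c • h (F.d f) := by
  classical
  -- The second clause, solvability of the equation one degree higher, is what lets the recursion
  -- continue.
  let P : ℕ → (F.Total →ₗ[MvPolynomial (Fin n) k] G.Total) → Prop := fun i g =>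
    (∀ a, ∀ f ∈ F.part i a, g f ∈ G.part (i + r) a) ∧
    ∀ e, F.hdeg e = i + 1 → ∃ y, G.d y = t (F.basisElem e) + c • g (F.d (F.basisElem e))
  have step : ∀ i, ∀ g : {g // P i g}, ∃ g' : {g' // P (i + 1) g'},
      ∀ f ∈ F.hpart (i + 1), G.d (g'.1 f) = t f + c • g.1 (F.d f) := by
    rintro i ⟨g, hg, hg'⟩
    have mem : ∀ j a f, f ∈ F.part (j + 1) a → ∀ g : F.Total →ₗ[MvPolynomial (Fin n) k] G.Total,
        (∀ a, ∀ f ∈ F.part j a, g f ∈ G.part (j + r) a) →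
          t f + c • g (F.d f) ∈ G.part (j + r) a := by
      intro j a f hf g hg
      have := smul_mem_bigradedPart hc (hg a _ (F.d_mem _ _ _ hf))
      rw [zero_add] at this
      exact Submodule.add_mem _ (t_mem j a f hf) this
    obtain ⟨g', h1, h2⟩ := exists_map_of_basis F G (i + 1) (i + 1 + r)
      (fun e y => G.d y = t (F.basisElem e) + c • g (F.d (F.basisElem e))) (by
        intro e he
        have hb := F.basisElem_mem_part e
        rw [he] at hb
        rw [show i + 1 + r = i + r + 1 by omega]
        exact G.exists_mem_part_d_eq (mem i _ _ hb g hg) (hg' e he))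
    have h3 : ∀ f ∈ F.hpart (i + 1), G.d (g' f) = t f + c • g (F.d f) := by
      have : F.hpart (i + 1) ≤ LinearMap.eqLocus (G.d ∘ₗ g') (t + c • (g ∘ₗ F.d)) :=
        homologicalPart_le h2
      exact this
    refine ⟨⟨g', h1, fun e he => ?_⟩, h3⟩
    have hb := F.basisElem_mem_part e
    rw [he] at hb
    have hm := mem (i + 1) _ _ hb g' h1
    rw [show i + 1 + r = i + r + 1 by omega] at hm
    -- By `t_d` and `∂² = 0` the right-hand side is a cycle in positive degree, hence a boundary.
    obtain ⟨y, -, hy⟩ := G.exists_mem_part_of_d_eq_zero hm (by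
      rw [map_add, map_smul, h3 _ (bigradedPart_le (F.d_mem _ _ _ hb)), F.d_d, map_zero,
        smul_zero, add_zero, t_d])
    exact ⟨y, hy⟩
  choose next hnext using step
  let gs : ∀ i, {g // P i g} := fun i =>
    Nat.rec ⟨h₀, fun a f hf => (Nat.zero_add r).symm ▸ h₀_mem a f hf, h₁⟩ next i
  have hgs : ∀ i, gs (i + 1) = next i (gs i) := fun i => rfl
  -- The maps `gs i` are unrelated outside degree `i`; only the degree `i` part of each is kept.
  let h : F.Total →ₗ[MvPolynomial (Fin n) k] G.Total :=
    Finsupp.linearCombination _ fun e => (gs (F.hdeg e)).1 (F.basisElem e)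
  have hh : ∀ i, ∀ f ∈ F.hpart i, h f = (gs i).1 f := fun i => by
    have : F.hpart i ≤ LinearMap.eqLocus h (gs i).1 := homologicalPart_le fun e he => by
      simp only [LinearMap.mem_eqLocus, h]
      rw [Finsupp.linearCombination_single, one_smul, he]
    exact this
  refine ⟨h, hh 0, fun i a f hf => ?_, fun i f hf => ?_⟩
  · rw [hh i f (bigradedPart_le hf)]
    exact (gs i).2.1 a f hf
  · rw [hh _ f hf, hh _ _ (F.d_mem_hpart hf), hgs]
    exact hnext i (gs i) f hf

/-- Linear maps agree on the total module if they agree on all homological parts. -/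
theorem eq_of_forall_hpart {F : MultigradedFreeResolution.{u, v} I} {M : Type*} [AddCommGroup M]
    [Module (MvPolynomial (Fin n) k) M] {g g' : F.Total →ₗ[MvPolynomial (Fin n) k] M}
    (h : ∀ i, ∀ f ∈ F.hpart i, g f = g' f) : g = g' := by
  refine Finsupp.lhom_ext' fun e => LinearMap.ext_ring ?_
  exact h _ _ (F.basisElem_mem_hpart e)

theorem isMultihomogeneous_one : IsMultihomogeneous (1 : MvPolynomial (Fin n) k) 0 := by
  have := isMultihomogeneous_monomial (a := 0) (m := (0 : Fin n →₀ ℕ)) (1 : k) (by simp)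
  exact this

theorem isMultihomogeneous_neg_one : IsMultihomogeneous (-1 : MvPolynomial (Fin n) k) 0 := by
  have := isMultihomogeneous_one (k := k) (n := n)
  intro m hm
  rw [support_neg] at hm
  exact this m hm

/-- A homogeneous chain map between two resolutions. -/
theorem exists_chainMap (F : MultigradedFreeResolution.{u, v} I)
    (G : MultigradedFreeResolution.{u, w} I) (hI : IsSquarefreeMonomialIdeal I) :
    ∃ φ : F.Total →ₗ[MvPolynomial (Fin n) k] G.Total,
      (∀ i a, ∀ f ∈ F.part i a, φ f ∈ G.part i a) ∧
      (∀ f ∈ F.hpart 0, G.aug (φ f) = F.aug f) ∧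
      ∀ f, G.d (φ f) = φ (F.d f) := by
  obtain ⟨φ₀, h1, h2⟩ := exists_map_of_basis F G 0 0
    (fun e y => G.aug y = F.aug (F.basisElem e)) (by
      intro e he
      have hb := F.basisElem_mem_part e
      rw [he] at hb
      obtain ⟨p, hp, hp'⟩ := F.ε_mem _ ⟨_, bigradedPart_le hb⟩ hb
      rw [F.aug_of_mem (bigradedPart_le hb), hp']
      exact G.exists_aug_eq hI hp)
  have h3 : ∀ f ∈ F.hpart 0, G.aug (φ₀ f) = F.aug f := by
    have : F.hpart 0 ≤ LinearMap.eqLocus (G.aug ∘ₗ φ₀) F.aug := homologicalPart_le h2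
    exact this
  obtain ⟨φ, h4, h5, h6⟩ := exists_lift F G 0 1 isMultihomogeneous_one 0 φ₀ h1
    (fun _ _ _ _ => by
      rw [LinearMap.zero_apply]
      exact zero_mem _) (by simp) (fun e he => by
      have hb := F.basisElem_mem_part e
      rw [he] at hb
      have hd := F.d_mem 0 _ _ hb
      obtain ⟨y, -, hy⟩ := G.exists_mem_part_of_aug_eq_zero (h1 _ _ hd) (by
        rw [h3 _ (bigradedPart_le hd), F.aug_d (bigradedPart_le hb)])
      exact ⟨y, by rw [hy, LinearMap.zero_apply, zero_add, one_smul]⟩)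
  refine ⟨φ, h5, fun f hf => by rw [h4 f hf, h3 f hf], ?_⟩
  have : G.d ∘ₗ φ = φ ∘ₗ F.d := by
    refine eq_of_forall_hpart fun i f hf => ?_
    simp only [LinearMap.comp_apply]
    cases i with
    | zero =>
      rw [F.d_zero f hf, map_zero]
      refine G.d_zero _ ?_
      have : F.hpart 0 ≤ (G.hpart 0).comap φ := homologicalPart_le fun e he => by
        have hb := F.basisElem_mem_part e
        rw [he] at hb
        exact bigradedPart_le (h5 _ _ _ hb)
      exact this hf
    | succ i => rw [h6 i f hf, LinearMap.zero_apply, zero_add, one_smul]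
  exact LinearMap.congr_fun this

/-- A homogeneous chain endomorphism that induces `0` on `S/I` is null-homotopic. -/
theorem exists_homotopy (G : MultigradedFreeResolution.{u, w} I)
    (θ : G.Total →ₗ[MvPolynomial (Fin n) k] G.Total)
    (θ_mem : ∀ i a, ∀ f ∈ G.part i a, θ f ∈ G.part i a)
    (θ_aug : ∀ f ∈ G.hpart 0, G.aug (θ f) = 0) (θ_d : ∀ f, G.d (θ f) = θ (G.d f)) :
    ∃ h : G.Total →ₗ[MvPolynomial (Fin n) k] G.Total,
      (∀ i a, ∀ f ∈ G.part i a, h f ∈ G.part (i + 1) a) ∧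
      ∀ f, G.d (h f) = θ f - h (G.d f) := by
  obtain ⟨h₀, h1, h2⟩ := exists_map_of_basis G G 0 1 (fun e y => G.d y = θ (G.basisElem e)) (by
    intro e he
    have hb := G.basisElem_mem_part e
    rw [he] at hb
    exact G.exists_mem_part_of_aug_eq_zero (θ_mem _ _ _ hb) (θ_aug _ (bigradedPart_le hb)))
  have h3 : ∀ f ∈ G.hpart 0, G.d (h₀ f) = θ f := by
    have : G.hpart 0 ≤ LinearMap.eqLocus (G.d ∘ₗ h₀) θ := homologicalPart_le h2
    exact this
  obtain ⟨h, h4, h5, h6⟩ := exists_lift G G 1 (-1) isMultihomogeneous_neg_one θ h₀ h1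
    (fun i a f hf => θ_mem (i + 1) a f hf) (fun f => by rw [θ_d, neg_smul, one_smul, add_neg_cancel])
    (fun e he => by
      have hb := G.basisElem_mem_part e
      rw [he] at hb
      have hd := G.d_mem 0 _ _ hb
      rw [neg_smul, one_smul, ← sub_eq_add_neg]
      obtain ⟨y, -, hy⟩ := G.exists_mem_part_of_d_eq_zero
        (Submodule.sub_mem _ (θ_mem _ _ _ hb) (h1 _ _ hd)) (by
          rw [map_sub, h3 _ (bigradedPart_le hd), θ_d, sub_self])
      exact ⟨y, hy⟩)
  refine ⟨h, h5, ?_⟩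
  have : G.d ∘ₗ h = θ - h ∘ₗ G.d := by
    refine eq_of_forall_hpart fun i f hf => ?_
    simp only [LinearMap.comp_apply, LinearMap.sub_apply]
    cases i with
    | zero => rw [G.d_zero f hf, map_zero, sub_zero, h4 f hf, h3 f hf]
    | succ i => rw [h6 i f hf, neg_smul, one_smul, ← sub_eq_add_neg]
  exact LinearMap.congr_fun this

/-- Two homogeneous chain maps between resolutions of `S/I`, in opposite directions, that lift the
identity are inverse to each other up to homotopy. -/
theorem exists_homotopy_comp (F : MultigradedFreeResolution.{u, v} I)
    (G : MultigradedFreeResolution.{u, w} I)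
    {φ : F.Total →ₗ[MvPolynomial (Fin n) k] G.Total}
    {ψ : G.Total →ₗ[MvPolynomial (Fin n) k] F.Total}
    (φ_mem : ∀ i a, ∀ f ∈ F.part i a, φ f ∈ G.part i a)
    (ψ_mem : ∀ i a, ∀ f ∈ G.part i a, ψ f ∈ F.part i a)
    (φ_aug : ∀ f ∈ F.hpart 0, G.aug (φ f) = F.aug f)
    (ψ_aug : ∀ f ∈ G.hpart 0, F.aug (ψ f) = G.aug f)
    (φ_d : ∀ f, G.d (φ f) = φ (F.d f)) (ψ_d : ∀ f, F.d (ψ f) = ψ (G.d f)) :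
    ∃ h : G.Total →ₗ[MvPolynomial (Fin n) k] G.Total,
      (∀ i a, ∀ f ∈ G.part i a, h f ∈ G.part (i + 1) a) ∧
      ∀ f, φ (ψ f) = f + G.d (h f) + h (G.d f) := by
  obtain ⟨h, h1, h2⟩ := G.exists_homotopy (φ ∘ₗ ψ - LinearMap.id)
    (fun i a f hf => Submodule.sub_mem _ (φ_mem _ _ _ (ψ_mem _ _ _ hf)) hf)
    (fun f hf => by
      have : G.hpart 0 ≤ (F.hpart 0).comap ψ := homologicalPart_le fun e he => by
        have hb := G.basisElem_mem_part e
        rw [he] at hb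
        exact bigradedPart_le (ψ_mem _ _ _ hb)
      rw [LinearMap.sub_apply, map_sub, LinearMap.comp_apply, φ_aug _ (this hf), ψ_aug f hf,
        LinearMap.id_apply, sub_self])
    (fun f => by simp [φ_d, ψ_d])
  refine ⟨h, h1, fun f => ?_⟩
  rw [h2, LinearMap.sub_apply, LinearMap.comp_apply, LinearMap.id_apply]
  abel

/-! ### Betti numbers read off from the minimal resolution. -/

/-- The submodule `𝔪 F`. -/
noncomputable abbrev maxSmul (F : MultigradedFreeResolution.{u, v} I) :
    Submodule (MvPolynomial (Fin n) k) F.Total :=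
  maxHomogeneousIdeal k n • ⊤

theorem map_mem_maxSmul {F : MultigradedFreeResolution.{u, v} I}
    {G : MultigradedFreeResolution.{u, w} I} (g : F.Total →ₗ[MvPolynomial (Fin n) k] G.Total)
    {f : F.Total} (hf : f ∈ F.maxSmul) : g f ∈ G.maxSmul :=
  Submodule.smul_top_le_comap_smul_top _ g hf

theorem basisElem_notMem_maxSmul (F : MultigradedFreeResolution.{u, v} I) (e : F.B) :
    F.basisElem e ∉ F.maxSmul := by
  intro h
  have := mem_maxHomogeneousIdeal_smul_top_iff.1 h e
  rw [Finsupp.single_eq_same, coeff_zero_one] at this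
  exact one_ne_zero this

theorem exists_basis_of_notMem_maxSmul {F : MultigradedFreeResolution.{u, v} I} {i : ℕ}
    {a : Fin n → ℤ} {f : F.Total} (hf : f ∈ F.part i a) (h : f ∉ F.maxSmul) :
    ∃ e, F.hdeg e = i ∧ F.mdeg e = a := by
  rw [mem_maxHomogeneousIdeal_smul_top_iff] at h
  push Not at h
  obtain ⟨e, he⟩ := h
  obtain ⟨h1, h2⟩ := hf e 0 (mem_support_iff.2 he)
  exact ⟨e, h1, funext fun l => by simpa using h2 l⟩

/-- Each of the finitely many basis elements of degree `i` contributes at most one monomial in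
multidegree `a`. Finiteness matters because `finrank` is `0` on infinite-dimensional spaces. -/
instance finite_residuePart (G : MultigradedFreeResolution.{u, v} I) (i : ℕ) (a : Fin n → ℤ) :
    Module.Finite k (G.residuePart i a) := by
  classical
  have hle : G.part i a ≤ Submodule.span k
      ((fun e => Finsupp.single e (monomial (expOf (a - G.mdeg e)) (1 : k))) '' {e | G.hdeg e = i}) := by
    intro f hf
    rw [mem_bigradedPart_iff, mem_homologicalPart_iff] at hf
    rw [← Finsupp.sum_single f]
    refine Submodule.sum_mem _ fun e he => ?_
    rw [(hf.2 e).eq_monomial, ← mul_one (coeff _ _), ← smul_eq_mul, ← smul_monomial,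
      ← Finsupp.smul_single]
    exact Submodule.smul_mem _ _
      (Submodule.subset_span ⟨e, hf.1 e (Finsupp.mem_support_iff.1 he), rfl⟩)
  have := Module.Finite.span_of_finite k ((G.finite_hdeg i).image
    fun e => Finsupp.single e (monomial (expOf (a - G.mdeg e)) (1 : k)))
  have := Submodule.finiteDimensional_of_le hle
  unfold residuePart
  infer_instance

theorem multigradedBetti_ne_zero_iff_exists_cycle (G : MultigradedFreeResolution.{u, v} I) (i : ℕ)
    (a : Fin n → ℤ) : G.multigradedBetti i a ≠ 0 ↔
      ∃ z ∈ G.part i a, G.d z ∈ G.maxSmul ∧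
        ∀ y ∈ G.part (i + 1) a, z - G.d y ∉ G.maxSmul := by
  have : Module.Finite k (G.torCycles i a) :=
    Submodule.finiteDimensional_of_le (inf_le_left : G.torCycles i a ≤ G.residuePart i a)
  unfold multigradedBetti
  rw [← Nat.pos_iff_ne_zero, Module.finrank_pos_iff, Submodule.Quotient.nontrivial_iff, Ne,
    Submodule.submoduleOf_eq_top, SetLike.not_le_iff_exists]
  constructor
  · rintro ⟨_, ⟨⟨z, hz, rfl⟩, hdz⟩, h⟩
    refine ⟨z, hz, ?_, fun y hy hzy => h ?_⟩
    · exact (Submodule.Quotient.mk_eq_zero _).1 hdz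
    · refine ⟨Submodule.Quotient.mk y, ⟨y, hy, rfl⟩, ?_⟩
      exact ((Submodule.Quotient.eq _).2 hzy).symm
  · rintro ⟨z, hz, hdz, h⟩
    refine ⟨Submodule.Quotient.mk z, ⟨⟨z, hz, rfl⟩, ?_⟩, ?_⟩
    · exact (Submodule.Quotient.mk_eq_zero G.maxSmul).2 hdz
    · rintro ⟨_, ⟨y, hy, rfl⟩, hyz⟩
      exact h y hy ((Submodule.Quotient.eq _).1 hyz.symm)

/-- The multigraded Betti numbers are read off from the basis of the minimal resolution. -/
theorem multigradedBetti_ne_zero_iff (hI : IsSquarefreeMonomialIdeal I)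
    (F : MultigradedFreeResolution.{u, v} I) (hF : F.IsMinimal)
    (G : MultigradedFreeResolution.{u, w} I) (i : ℕ) (a : Fin n → ℤ) :
    G.multigradedBetti i a ≠ 0 ↔ ∃ e, F.hdeg e = i ∧ F.mdeg e = a := by
  rw [multigradedBetti_ne_zero_iff_exists_cycle]
  obtain ⟨φ, φ_mem, φ_aug, φ_d⟩ := exists_chainMap F G hI
  obtain ⟨ψ, ψ_mem, ψ_aug, ψ_d⟩ := exists_chainMap G F hI
  constructor
  · rintro ⟨z, hz, hdz, H⟩
    refine exists_basis_of_notMem_maxSmul (ψ_mem _ _ _ hz) fun hψ => ?_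
    obtain ⟨h, h_mem, hh⟩ := exists_homotopy_comp F G φ_mem ψ_mem φ_aug ψ_aug φ_d ψ_d
    -- If `ψ z ∈ 𝔪F`, the homotopy `φψ = 1 + ∂h + h∂` exhibits `z` as a boundary modulo `𝔪G`,
    -- because `∂z ∈ 𝔪G`.
    refine H (-h z) (Submodule.neg_mem _ (h_mem _ _ _ hz)) ?_
    have e : z - G.d (-h z) = φ (ψ z) - h (G.d z) := by
      rw [hh, map_neg]
      abel
    rw [e]
    exact Submodule.sub_mem _ (map_mem_maxSmul φ hψ) (map_mem_maxSmul h hdz)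
  · rintro ⟨e, rfl, rfl⟩
    obtain ⟨h, h_mem, hh⟩ := exists_homotopy_comp G F ψ_mem φ_mem ψ_aug φ_aug ψ_d φ_d
    refine ⟨φ (F.basisElem e), φ_mem _ _ _ (F.basisElem_mem_part e), ?_, fun y hy H => ?_⟩
    · rw [φ_d]
      exact map_mem_maxSmul φ (hF _)
    · refine F.basisElem_notMem_maxSmul e ?_
      have e1 : F.basisElem e = ψ (φ (F.basisElem e) - G.d y) + F.d (ψ y)
          - F.d (h (F.basisElem e)) - h (F.d (F.basisElem e)) := by
        rw [map_sub, hh, ψ_d]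
        abel
      rw [e1]
      exact Submodule.sub_mem _ (Submodule.sub_mem _
        (Submodule.add_mem _ (map_mem_maxSmul ψ H) (hF _)) (hF _)) (map_mem_maxSmul h (hF _))

theorem gradedBetti_ne_zero_iff (hI : IsSquarefreeMonomialIdeal I)
    (F : MultigradedFreeResolution.{u, v} I) (hF : F.IsMinimal)
    (G : MultigradedFreeResolution.{u, w} I) (i : ℕ) (j : ℤ) :
    G.gradedBetti i j ≠ 0 ↔ ∃ e, F.hdeg e = i ∧ ∑ l, F.mdeg e l = j := by
  have key := multigradedBetti_ne_zero_iff hI F hF G i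
  unfold gradedBetti
  -- `finsum` is `0` on infinite support, so finiteness is needed before the summands can be
  -- examined.
  have hfin : (Function.support fun a : {a : Fin n → ℤ // ∑ l, a l = j} =>
      G.multigradedBetti i a).Finite := by
    refine Set.Finite.of_finite_image (f := Subtype.val)
      (((F.finite_hdeg i).image F.mdeg).subset ?_) Subtype.val_injective.injOn
    rintro _ ⟨a, ha, rfl⟩
    obtain ⟨e, h1, h2⟩ := (key a).1 ha
    exact ⟨e, h1, h2⟩
  rw [finsum_eq_sum _ hfin, Ne, Finset.sum_eq_zero_iff]
  push Not
  constructor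
  · rintro ⟨a, -, ha⟩
    obtain ⟨e, h1, h2⟩ := (key a).1 ha
    exact ⟨e, h1, by rw [h2, a.2]⟩
  · rintro ⟨e, h1, h2⟩
    have := (key (F.mdeg e)).2 ⟨e, h1, rfl⟩
    exact ⟨⟨F.mdeg e, h2⟩, by simpa using this, this⟩

theorem finite_gradedBetti_ne_zero (hI : IsSquarefreeMonomialIdeal I)
    (F : MultigradedFreeResolution.{u, v} I) (hF : F.IsMinimal)
    (G : MultigradedFreeResolution.{u, w} I) (i : ℕ) : {j : ℤ | G.gradedBetti i j ≠ 0}.Finite := by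
  refine ((F.finite_hdeg i).image fun e => ∑ l, F.mdeg e l).subset fun j hj => ?_
  obtain ⟨e, h1, h2⟩ := (gradedBetti_ne_zero_iff hI F hF G i j).1 hj
  exact ⟨e, h1, h2⟩

/-- `sSup` in `ℤ` defaults to `0` on empty or unbounded sets; a basis element of degree `i` rules
out the first, finiteness of the basis of `Fᵢ` the second. -/
theorem isGreatest_maxShift (hI : IsSquarefreeMonomialIdeal I)
    (F : MultigradedFreeResolution.{u, v} I) (hF : F.IsMinimal)
    (G : MultigradedFreeResolution.{u, w} I) {i : ℕ} (hi : ∃ e, F.hdeg e = i) :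
    IsGreatest {j : ℤ | G.gradedBetti i j ≠ 0} (G.maxShift i) := by
  have hfin := finite_gradedBetti_ne_zero hI F hF G i
  obtain ⟨e, he⟩ := hi
  refine ⟨Int.csSup_mem ⟨_, (gradedBetti_ne_zero_iff hI F hF G i _).2 ⟨e, he, rfl⟩⟩
    hfin.bddAbove, fun j hj => ?_⟩
  exact le_csSup hfin.bddAbove hj

theorem sum_mdeg_le_maxShift (hI : IsSquarefreeMonomialIdeal I)
    (F : MultigradedFreeResolution.{u, v} I) (hF : F.IsMinimal)
    (G : MultigradedFreeResolution.{u, w} I) (e : F.B) :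
    ∑ l, F.mdeg e l ≤ G.maxShift (F.hdeg e) :=
  le_csSup (finite_gradedBetti_ne_zero hI F hF G _).bddAbove
    ((gradedBetti_ne_zero_iff hI F hF G _ _).2 ⟨e, rfl, rfl⟩)

/-! ### Projective dimension and the length of a resolution. -/

/-- Each `Fᵢ` is isomorphic to some `S^r`. -/
theorem exists_hpart_equiv (F : MultigradedFreeResolution.{u, v} I) (i : ℕ) :
    ∃ r : ℕ, Nonempty (F.hpart i ≃ₗ[MvPolynomial (Fin n) k] (Fin r →₀ MvPolynomial (Fin n) k)) := by
  have := (F.finite_hdeg i).to_subtype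
  obtain ⟨r, ⟨e⟩⟩ := Finite.exists_equiv_fin {e | F.hdeg e = i}
  exact ⟨r, ⟨(Finsupp.supportedEquivFinsupp _).trans (Finsupp.domLCongr e)⟩⟩

/-- If `F_{j+m} = 0` then the cokernel of `F_{j+1} → F_j` has projective dimension less than `m`. -/
theorem hasProjectiveDimensionLT_of_hpart (F : MultigradedFreeResolution.{u, v} I) (m : ℕ) :
    ∀ (j : ℕ) (M : Type u) [AddCommGroup M] [Module (MvPolynomial (Fin n) k) M]
      (p : F.hpart j →ₗ[MvPolynomial (Fin n) k] M), Function.Surjective p →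
      (∀ f : F.hpart j, p f = 0 ↔ ∃ g ∈ F.hpart (j + 1), F.d g = f) →
      (∀ e, F.hdeg e ≠ j + m) →
      CategoryTheory.HasProjectiveDimensionLT (ModuleCat.of (MvPolynomial (Fin n) k) M) m := by
  induction m with
  | zero =>
    intro j M _ _ p hp _ hj
    have : Subsingleton M := by
      refine ⟨fun x y => ?_⟩
      obtain ⟨f, rfl⟩ := hp x
      obtain ⟨g, rfl⟩ := hp y
      have h0 : ∀ f : F.hpart j, f = 0 := fun f => Subtype.ext <| Finsupp.ext fun e => by
        by_contra h
        exact hj e (mem_homologicalPart_iff.1 f.2 e h)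
      rw [h0 f, h0 g]
    exact (ModuleCat.isZero_of_subsingleton _).hasProjectiveDimensionLT_zero
  | succ m ih =>
    intro j M _ _ p hp hker hj
    -- Coordinates replace `F_j` by a free module in the universe of `M`, so that `0 → ker q → S^r →
    -- M → 0` lives in one `ModuleCat` and permits dimension shifting.
    obtain ⟨r, ⟨E⟩⟩ := F.exists_hpart_equiv j
    let q : (Fin r →₀ MvPolynomial (Fin n) k) →ₗ[MvPolynomial (Fin n) k] M := p ∘ₗ E.symm
    have hq : Function.Surjective q := hp.comp E.symm.surjective
    let d' : F.hpart (j + 1) →ₗ[MvPolynomial (Fin n) k] F.hpart j :=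
      F.d.restrict fun _ hf => F.d_mem_hpart hf
    have hd' : ∀ f, q (E (d' f)) = 0 := fun f => by
      simp only [q, LinearMap.comp_apply, LinearEquiv.coe_coe, E.symm_apply_apply]
      exact (hker _).2 ⟨f, f.2, rfl⟩
    let p' : F.hpart (j + 1) →ₗ[MvPolynomial (Fin n) k] LinearMap.ker q :=
      (E.toLinearMap ∘ₗ d').codRestrict _ hd'
    have h1 := ih (j + 1) (LinearMap.ker q) p' (by
      rintro ⟨y, hy⟩
      obtain ⟨g, hg, hgy⟩ := (hker (E.symm y)).1 hy
      refine ⟨⟨g, hg⟩, Subtype.ext ?_⟩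
      have : d' ⟨g, hg⟩ = E.symm y := Subtype.ext hgy
      change E (d' ⟨g, hg⟩) = y
      rw [this, E.apply_symm_apply]) (by
      intro f
      have h2 : p' f = 0 ↔ F.d f = 0 := by
        rw [Subtype.ext_iff]
        change E (d' f) = 0 ↔ _
        rw [E.map_eq_zero_iff, Subtype.ext_iff]
        rfl
      rw [h2]
      refine ⟨F.exact_succ j f f.2, ?_⟩
      rintro ⟨g, -, hg⟩
      rw [← hg, F.d_d]) (fun e he => hj e (by omega))
    exact (LinearMap.shortExact_shortComplexKer hq).hasProjectiveDimensionLT_X₃ m h1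
      (inferInstanceAs (CategoryTheory.HasProjectiveDimensionLT
        (ModuleCat.of (MvPolynomial (Fin n) k) (Fin r →₀ MvPolynomial (Fin n) k)) (m + 1)))

theorem exists_basis_of_le_projectiveDimension (F : MultigradedFreeResolution.{u, v} I) {i : ℕ}
    (hi : (i : WithBot ℕ∞) ≤ CategoryTheory.projectiveDimension
      (ModuleCat.of (MvPolynomial (Fin n) k) (MvPolynomial (Fin n) k ⧸ I))) :
    ∃ e, F.hdeg e = i := by
  by_contra! h
  refine (CategoryTheory.projectiveDimension_ge_iff _ _).1 hi
    (F.hasProjectiveDimensionLT_of_hpart i 0 _ F.ε F.ε_surjective F.exact_zero ?_)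
  simpa using h

/-! ### Multidegrees of the basis of a minimal resolution. -/

theorem mdeg_le_of_apply_ne_zero {F : MultigradedFreeResolution.{u, v} I} {i : ℕ} {a : Fin n → ℤ}
    {f : F.Total} (hf : f ∈ F.part i a) {e : F.B} (he : f e ≠ 0) (l : Fin n) :
    F.mdeg e l ≤ a l := by
  obtain ⟨m, hm⟩ := ne_zero_iff.1 he
  have := (hf e m (mem_support_iff.2 hm)).2 l
  omega

/-- Equal degrees would force the coefficient at `e` to be a nonzero constant, which `𝔪F` excludes.
Applied to `∂e`, this makes the induction on total degree terminate. -/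
theorem sum_mdeg_lt_of_mem_maxSmul {F : MultigradedFreeResolution.{u, v} I} {i : ℕ}
    {a : Fin n → ℤ} {f : F.Total} (hf : f ∈ F.part i a) (hf' : f ∈ F.maxSmul) {e : F.B}
    (he : f e ≠ 0) : ∑ l, F.mdeg e l < ∑ l, a l := by
  refine Finset.sum_lt_sum (fun l _ => mdeg_le_of_apply_ne_zero hf he l) ?_
  by_contra! H
  obtain ⟨m, hm⟩ := ne_zero_iff.1 he
  have : m = 0 := by
    ext l
    have h1 := (hf e m (mem_support_iff.2 hm)).2 l
    have h2 := H l (Finset.mem_univ l)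
    rw [Finsupp.zero_apply]
    omega
  rw [this] at hm
  exact hm (mem_maxHomogeneousIdeal_smul_top_iff.1 hf' e)

/-- Division of a homogeneous element by a monomial. -/
theorem exists_eq_monomial_smul {F : MultigradedFreeResolution.{u, v} I} {i : ℕ} {a b : Fin n → ℤ}
    {f : F.Total} (hf : f ∈ F.part i a) (m : Fin n →₀ ℕ) (hab : ∀ l, a l = m l + b l)
    (h : ∀ e, f e ≠ 0 → ∀ l, F.mdeg e l ≤ b l) :
    ∃ g ∈ F.part i b, f = monomial m (1 : k) • g := by
  classical
  refine ⟨f.mapRange (fun p => p.divMonomial m) (zero_divMonomial m), fun e m' hm' => ?_, ?_⟩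
  · rw [Finsupp.mapRange_apply, mem_support_iff, coeff_divMonomial] at hm'
    obtain ⟨h1, h2⟩ := hf e _ (mem_support_iff.2 hm')
    refine ⟨h1, fun l => ?_⟩
    have := h2 l
    have := hab l
    rw [Finsupp.add_apply] at *
    push_cast at *
    omega
  · ext e m'
    rw [Finsupp.smul_apply, smul_eq_mul, Finsupp.mapRange_apply, coeff_monomial_mul', one_mul,
      coeff_divMonomial]
    split_ifs with hm
    · rw [add_tsub_cancel_of_le hm]
    · by_contra h0
      refine hm fun l => ?_
      have h1 := (hf e m' (mem_support_iff.2 h0)).2 l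
      have h2 := h e (fun h => h0 (by rw [h, coeff_zero])) l
      have := hab l
      omega

theorem IsMinimal.d_basisElem_ne_zero {F : MultigradedFreeResolution.{u, v} I} (hF : F.IsMinimal)
    {i : ℕ} {e : F.B} (he : F.hdeg e = i + 1) : F.d (F.basisElem e) ≠ 0 := by
  intro h
  have hb := F.basisElem_mem_hpart e
  rw [he] at hb
  obtain ⟨g, -, hg⟩ := F.exact_succ i _ hb h
  refine F.basisElem_notMem_maxSmul e ?_
  rw [← hg]
  exact hF g

theorem IsMinimal.exists_d_basisElem_apply_ne_zero {F : MultigradedFreeResolution.{u, v} I}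
    (hF : F.IsMinimal) {i : ℕ} {e : F.B} (he : F.hdeg e = i + 1) :
    ∃ e', F.hdeg e' = i ∧ F.d (F.basisElem e) e' ≠ 0 := by
  obtain ⟨e', he'⟩ := Finsupp.ne_iff.1 (hF.d_basisElem_ne_zero he)
  have hb := F.basisElem_mem_hpart e
  rw [he] at hb
  exact ⟨e', mem_homologicalPart_iff.1 (F.d_mem_hpart hb) e' he', he'⟩

/-- Below every basis element of positive homological degree there is one of degree `1`. -/
theorem IsMinimal.exists_hdeg_one {F : MultigradedFreeResolution.{u, v} I} (hF : F.IsMinimal)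
    (i : ℕ) : ∀ e, F.hdeg e = i + 1 → ∃ e', F.hdeg e' = 1 ∧ ∀ l, F.mdeg e' l ≤ F.mdeg e l := by
  induction i with
  | zero => exact fun e he => ⟨e, he, fun _ => le_rfl⟩
  | succ i ih =>
    intro e he
    obtain ⟨e', he', h⟩ := hF.exists_d_basisElem_apply_ne_zero he
    obtain ⟨e'', h1, h2⟩ := ih e' he'
    have hb := F.basisElem_mem_part e
    rw [he] at hb
    exact ⟨e'', h1, fun l => (h2 l).trans (mdeg_le_of_apply_ne_zero (F.d_mem _ _ _ hb) h l)⟩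

/-- Since `F₀ = S · 1`, the basis element is `s • 1`, so the coefficient of `1` at `e` is a unit;
its constant term is nonzero while `1` has multidegree `0`. -/
theorem DGAStructure.mdeg_eq_zero {F : MultigradedFreeResolution.{u, v} I} (D : F.DGAStructure)
    {e : F.B} (he : F.hdeg e = 0) : F.mdeg e = 0 := by
  have hb := F.basisElem_mem_hpart e
  rw [he] at hb
  obtain ⟨s, hs⟩ := D.eq_smul_one ⟨_, hb⟩
  have h1 : (1 : MvPolynomial (Fin n) k) = s * (D.one : F.Total) e := by
    have := DFunLike.congr_fun (congrArg Subtype.val hs) e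
    rwa [Finsupp.single_eq_same] at this
  have h2 : coeff 0 ((D.one : F.Total) e) ≠ 0 := by
    intro h
    have := congrArg constantCoeff h1
    rw [map_mul, constantCoeff_eq, h, mul_zero,
      coeff_zero_one] at this
    exact one_ne_zero this
  funext l
  simpa using (D.one_mem e 0 (mem_support_iff.2 h2)).2 l

/-- The multidegrees of a minimal resolution of a squarefree monomial ideal are squarefree. -/
theorem DGAStructure.mdeg_squarefree {F : MultigradedFreeResolution.{u, v} I} (D : F.DGAStructure)
    (hF : F.IsMinimal) (hI : IsSquarefreeMonomialIdeal I) (i : ℕ) :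
    ∀ e, F.hdeg e = i → ∀ l, 0 ≤ F.mdeg e l ∧ F.mdeg e l ≤ 1 := by
  classical
  induction i with
  | zero =>
    intro e he l
    rw [D.mdeg_eq_zero he]
    simp
  | succ i ih =>
    intro e he l
    have hb := F.basisElem_mem_part e
    rw [he] at hb
    have hd := F.d_mem _ _ _ hb
    refine ⟨?_, ?_⟩
    · obtain ⟨e', he', h⟩ := hF.exists_d_basisElem_apply_ne_zero he
      exact (ih e' he' l).1.trans (mdeg_le_of_apply_ne_zero hd h l)
    · by_contra! hl
      -- Assuming `mdeg e l ≥ 2`, every basis element in `∂e` has `l`-degree at most `1` by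
      -- induction, so `∂e = X l • w` with `w` of multidegree `b`.
      set b : Fin n → ℤ := fun l' => F.mdeg e l' - (Finsupp.single l 1 : Fin n →₀ ℕ) l' with hbdef
      have hbl : b l = F.mdeg e l - 1 := by simp [hbdef]
      obtain ⟨w, hw, hw'⟩ := exists_eq_monomial_smul (b := b) hd (Finsupp.single l 1)
        (fun l' => by simp [hbdef]) (fun e' he' l' => by
          by_cases hll : l = l'
          · subst hll
            have := (ih e' (mem_homologicalPart_iff.1 (bigradedPart_le hd) e' he') l).2
            omega
          · have := mdeg_le_of_apply_ne_zero hd he' l'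
            simpa [hbdef, Finsupp.single_eq_of_ne' hll] using this)
      change _ = (X l : MvPolynomial (Fin n) k) • w at hw'
      obtain ⟨g, hg, hgw⟩ : ∃ g ∈ F.part (i + 1) b, F.d g = w := by
        cases i with
        | zero =>
          refine F.exists_mem_part_of_aug_eq_zero hw ?_
          obtain ⟨p, hp, hp'⟩ := F.ε_mem b ⟨w, bigradedPart_le hw⟩ hw
          rw [F.aug_of_mem (bigradedPart_le hw), hp', Ideal.Quotient.eq_zero_iff_mem]
          -- Squarefreeness of `I` enters here: `b l ≥ 1` allows cancelling `X l` modulo `I`.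
          refine hI.mem_of_X_mul_mem hp (by omega : 1 ≤ b l) ?_
          have := F.aug_d (bigradedPart_le hb)
          rw [hw', map_smul, F.aug_of_mem (bigradedPart_le hw), hp'] at this
          rw [← Ideal.Quotient.eq_zero_iff_mem, map_mul, ← this]
          rfl
        | succ i =>
          refine F.exists_mem_part_of_d_eq_zero hw ?_
          have := F.d_d (F.basisElem e)
          rw [hw', map_smul] at this
          exact (smul_eq_zero.1 this).resolve_left (X_ne_zero l)
      -- As `∂e = X l • ∂g`, the element `e - X l • g` is a cycle, hence a boundary in `𝔪F`; this
      -- puts `e` itself in `𝔪F`.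
      obtain ⟨g', -, hg'⟩ := F.exact_succ i (F.basisElem e - (X l : MvPolynomial (Fin n) k) • g)
        (Submodule.sub_mem _ (bigradedPart_le hb) (Submodule.smul_mem _ _ (bigradedPart_le hg)))
        (by rw [map_sub, map_smul, hgw, hw', sub_self])
      refine F.basisElem_notMem_maxSmul e ?_
      rw [← sub_add_cancel (F.basisElem e) ((X l : MvPolynomial (Fin n) k) • g), ← hg']
      exact Submodule.add_mem _ (hF g')
        (Submodule.smul_mem_smul (Ideal.subset_span ⟨l, rfl⟩) trivial)

/-! ### The unit of the multiplication. -/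

theorem DGAStructure.d_one {F : MultigradedFreeResolution.{u, v} I} (D : F.DGAStructure) :
    F.d D.one = 0 :=
  F.d_zero _ D.one.2

/-- The element `1 ∈ F₀` is a unit element for the multiplication. -/
theorem DGAStructure.one_mul {F : MultigradedFreeResolution.{u, v} I} (D : F.DGAStructure)
    (hF : F.IsMinimal) (f : F.Total) : D.mul D.one f = f := by
  suffices H : ∀ i, ∀ f ∈ F.hpart i, D.mul D.one f = f from
    LinearMap.congr_fun (eq_of_forall_hpart (g' := LinearMap.id) H) f
  have hd : ∀ f, F.d (D.mul D.one f) = D.mul D.one (F.d f) := fun f => by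
    rw [D.leibniz 0 _ D.one.2, D.d_one, map_zero, LinearMap.zero_apply, zero_add, pow_zero, one_smul]
  have hmem : ∀ i, ∀ f ∈ F.hpart i, D.mul D.one f ∈ F.hpart i := fun i => by
    have : F.hpart i ≤ (F.hpart i).comap (D.mul D.one) := homologicalPart_le fun e he => by
      have hb := F.basisElem_mem_part e
      rw [he] at hb
      have := D.mul_mem 0 i _ _ _ D.one_mem _ hb
      rw [zero_add] at this
      exact bigradedPart_le this
    exact this
  intro i
  induction i with
  | zero =>
    intro f hf
    obtain ⟨s, hs⟩ := D.eq_smul_one ⟨f, hf⟩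
    have : f = s • (D.one : F.Total) := congrArg Subtype.val hs
    rw [this, map_smul, D.one_mul_one]
  | succ i ih =>
    -- Left multiplication by `1` is idempotent, so `N² = -N`. By induction `N` kills degree `i`, so
    -- in degree `i + 1` its values are cycles, hence boundaries in `𝔪F`. Iterating puts the
    -- coefficients of `N f` in every power of `𝔪`, and Krull's intersection theorem gives `N f =
    -- 0`.
    set N := D.mul D.one - LinearMap.id with hN
    have hNN : ∀ f, N f = - N (N f) := fun f => by
      simp only [hN, LinearMap.sub_apply, LinearMap.id_apply, map_sub]
      rw [← D.mul_assoc, D.one_mul_one]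
      abel
    have hN1 : ∀ f ∈ F.hpart (i + 1), N f ∈ F.hpart (i + 1) := fun f hf =>
      Submodule.sub_mem _ (hmem _ f hf) hf
    have hN2 : ∀ f ∈ F.hpart (i + 1), N f ∈ F.maxSmul := fun f hf => by
      obtain ⟨g, -, hg⟩ := F.exact_succ i _ (hN1 f hf) (by
        rw [hN, LinearMap.sub_apply, LinearMap.id_apply, map_sub, hd,
          ih _ (F.d_mem_hpart hf), sub_self])
      rw [← hg]
      exact hF g
    have hN3 : ∀ j : ℕ, ∀ f ∈ F.hpart (i + 1), ∀ e, N f e ∈ maxHomogeneousIdeal k n ^ j := by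
      intro j
      induction j with
      | zero => simp
      | succ j ihj =>
        intro f hf e
        rw [hNN, eq_sum_smul_single (N f), map_sum, Finsupp.neg_apply, Finsupp.finsetSum_apply]
        refine Ideal.neg_mem_iff _ |>.2 (Ideal.sum_mem _ fun e' he' => ?_)
        rw [map_smul, Finsupp.smul_apply, smul_eq_mul, pow_succ]
        refine Ideal.mul_mem_mul (ihj f hf e') (mem_maxHomogeneousIdeal_iff.2 ?_)
        have hb := F.basisElem_mem_hpart e'
        rw [mem_homologicalPart_iff.1 (hN1 f hf) e' (Finsupp.mem_support_iff.1 he')] at hb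
        exact mem_maxHomogeneousIdeal_smul_top_iff.1 (hN2 _ hb) e
    have htop : maxHomogeneousIdeal k n ≠ ⊤ := fun h => by
      have : (1 : MvPolynomial (Fin n) k) ∈ maxHomogeneousIdeal k n := by
        rw [h]
        trivial
      rw [mem_maxHomogeneousIdeal_iff, coeff_zero_one] at this
      exact one_ne_zero this
    intro f hf
    have h0 : N f = 0 := Finsupp.ext fun e => by
      have : N f e ∈ ⨅ j : ℕ, maxHomogeneousIdeal k n ^ j :=
        (Submodule.mem_iInf _).2 fun j => hN3 j f hf e
      rwa [Ideal.iInf_pow_eq_bot_of_isDomain _ htop] at this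
    rwa [hN, LinearMap.sub_apply, LinearMap.id_apply, sub_eq_zero] at h0

/-! ### Saturated products and multiplication by elements of degree one. -/

namespace DGAStructure

variable {F : MultigradedFreeResolution.{u, v} I}

/-- The elements of `F` of which a nonzero multiple lies in the submodule `F_a * F_c`. -/
noncomputable def satProd (D : F.DGAStructure) (a c : ℕ) :
    Submodule (MvPolynomial (Fin n) k) F.Total where
  carrier := {f | ∃ p : MvPolynomial (Fin n) k, p ≠ 0 ∧
    p • f ∈ Submodule.map₂ D.mul (F.hpart a) (F.hpart c)}
  zero_mem' := ⟨1, one_ne_zero, by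
    rw [smul_zero]
    exact zero_mem _⟩
  add_mem' := by
    rintro f g ⟨p, hp, hf⟩ ⟨q, hq, hg⟩
    refine ⟨p * q, mul_ne_zero hp hq, ?_⟩
    rw [smul_add]
    refine Submodule.add_mem _ ?_ ?_
    · rw [_root_.mul_comm, mul_smul]
      exact Submodule.smul_mem _ _ hf
    · rw [mul_smul]
      exact Submodule.smul_mem _ _ hg
  smul_mem' := by
    rintro s f ⟨p, hp, hf⟩
    refine ⟨p, hp, ?_⟩
    rw [smul_comm]
    exact Submodule.smul_mem _ _ hf

theorem mem_satProd_of_smul_mem (D : F.DGAStructure) {a c : ℕ} {p : MvPolynomial (Fin n) k}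
    (hp : p ≠ 0) {f : F.Total} (h : p • f ∈ D.satProd a c) : f ∈ D.satProd a c := by
  obtain ⟨q, hq, hf⟩ := h
  exact ⟨q * p, mul_ne_zero hq hp, by rwa [mul_smul]⟩

theorem mem_satProd_zero (D : F.DGAStructure) (hF : F.IsMinimal) {c : ℕ} {f : F.Total}
    (hf : f ∈ F.hpart c) : f ∈ D.satProd 0 c := by
  refine ⟨1, one_ne_zero, ?_⟩
  rw [one_smul, ← D.one_mul hF f]
  exact Submodule.apply_mem_map₂ _ D.one.2 hf

theorem mul_mem_hpart (D : F.DGAStructure) {i j : ℕ} {f g : F.Total} (hf : f ∈ F.hpart i)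
    (hg : g ∈ F.hpart j) : D.mul f g ∈ F.hpart (i + j) := by
  have h1 : ∀ e, F.hdeg e = i → F.hpart j ≤ (F.hpart (i + j)).comap (D.mul (F.basisElem e)) := by
    refine fun e he => homologicalPart_le fun e' he' => ?_
    subst he he'
    exact bigradedPart_le (D.mul_mem _ _ _ _ _ (F.basisElem_mem_part e) _ (F.basisElem_mem_part e'))
  have h2 : F.hpart i ≤ (F.hpart (i + j)).comap (D.mul.flip g) :=
    homologicalPart_le fun e he => h1 e he hg
  exact h2 hf

/-- Associativity: `F₁ * (F_a * F_c) = (F₁ * F_a) * F_c`, contained in `F_{a+1} * F_c`. -/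
theorem mul_mem_satProd (D : F.DGAStructure) {a c : ℕ} {f g : F.Total} (hf : f ∈ F.hpart 1)
    (hg : g ∈ D.satProd a c) : D.mul f g ∈ D.satProd (a + 1) c := by
  obtain ⟨p, hp, h⟩ := hg
  refine ⟨p, hp, ?_⟩
  rw [← map_smul]
  have : Submodule.map₂ D.mul (F.hpart a) (F.hpart c) ≤
      (Submodule.map₂ D.mul (F.hpart (a + 1)) (F.hpart c)).comap (D.mul f) := by
    refine Submodule.map₂_le.2 fun x hx y hy => ?_
    rw [Submodule.mem_comap, ← D.mul_assoc]
    refine Submodule.apply_mem_map₂ _ ?_ hy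
    rw [add_comm]
    exact D.mul_mem_hpart hf hx
  exact this h

/-- The differential of a basis element of homological degree `1` is a monomial. -/
theorem exists_d_eq_monomial_smul_one (D : F.DGAStructure) (hF : F.IsMinimal) {e : F.B}
    (he : F.hdeg e = 1) : ∃ (m : Fin n →₀ ℕ) (c : k), c ≠ 0 ∧ (∀ l, (m l : ℤ) = F.mdeg e l) ∧
      F.d (F.basisElem e) = monomial m c • (D.one : F.Total) := by
  have hb := F.basisElem_mem_part e
  rw [he] at hb
  have hd := F.d_mem _ _ _ hb
  obtain ⟨s, hs⟩ := D.eq_smul_one ⟨_, bigradedPart_le hd⟩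
  replace hs : F.d (F.basisElem e) = s • (D.one : F.Total) := congrArg Subtype.val hs
  have h0 := hF.d_basisElem_ne_zero he
  have hs0 : s ≠ 0 := by
    rintro rfl
    exact h0 (by rw [hs, zero_smul])
  have hone : (D.one : F.Total) ≠ 0 := fun h => h0 (by rw [hs, h, smul_zero])
  obtain ⟨e', he'⟩ := Finsupp.ne_iff.1 hone
  have hhom : IsMultihomogeneous s (F.mdeg e) := by
    -- The coefficient of `1` at `e'` is a single nonzero term, so the multidegree of `s` can be
    -- read off from the product.
    have h1 := (mem_bigradedPart_iff.1 D.one_mem).2 e'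
    have h2 := h1.eq_monomial
    set q := expOf (0 - F.mdeg e') with hq
    have hc : coeff q ((D.one : F.Total) e') ≠ 0 := fun h => he' (by
      rw [h2, h, monomial_zero]
      rfl)
    intro m hm l
    have h3 : m + q ∈ (F.d (F.basisElem e) e').support := by
      rw [hs, mem_support_iff, Finsupp.smul_apply, smul_eq_mul, h2, coeff_mul_monomial]
      exact mul_ne_zero (mem_support_iff.1 hm) hc
    have h4 := (hd e' _ h3).2 l
    have h5 := h1.expOf_apply he' l
    rw [Finsupp.add_apply] at h4
    rw [← hq, Pi.sub_apply, Pi.zero_apply] at h5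
    push_cast at h4
    omega
  refine ⟨expOf (F.mdeg e), coeff (expOf (F.mdeg e)) s, fun h => hs0 ?_,
    hhom.expOf_apply hs0, by rw [← hhom.eq_monomial, hs]⟩
  rw [hhom.eq_monomial, h, monomial_zero]

/-- Multiplication by an element of degree `1` decomposes `g`, up to a boundary and a nonzero
factor from `S`. -/
theorem exists_smul_sub_d_eq_mul (D : F.DGAStructure) (hF : F.IsMinimal)
    (hI : IsSquarefreeMonomialIdeal I) {e : F.B} (he : F.hdeg e = 1) {i : ℕ} {a : Fin n → ℤ}
    (hea : ∀ l, F.mdeg e l ≤ a l) {g : F.Total} (hg : g ∈ F.part i a) :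
    ∃ (s : MvPolynomial (Fin n) k), s ≠ 0 ∧ ∃ w ∈ F.part (i + 1) a,
      s • (g - F.d w) = D.mul (F.basisElem e) (F.d g) := by
  have hb := F.basisElem_mem_part e
  rw [he] at hb
  obtain ⟨m, c, hc, hm, hd⟩ := D.exists_d_eq_monomial_smul_one hF he
  have hmul := D.mul_mem _ _ _ _ _ hb _ hg
  rw [add_comm 1 i] at hmul
  -- A basis element in `e * g` has multidegree at most `mdeg e + a` and entries at most `1`. Where
  -- `a l ≥ 1` it is thus at most `a l`; where `a l ≤ 0`, nonnegativity of `mdeg e` and `hea` force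
  -- `mdeg e l = a l = 0`. Hence `x^m` divides `e * g`.
  obtain ⟨w, hw, hw'⟩ := exists_eq_monomial_smul (b := a) hmul m
    (fun l => by rw [Pi.add_apply, hm]) (fun e' he' l => by
      have h1 := mdeg_le_of_apply_ne_zero hmul he' l
      have h2 := D.mdeg_squarefree hF hI _ e' rfl l
      have h3 := hea l
      rw [Pi.add_apply] at h1
      omega)
  have hcc : IsMultihomogeneous (C c⁻¹ : MvPolynomial (Fin n) k) 0 :=
    isMultihomogeneous_monomial _ (by simp)
  have hw2 := smul_mem_bigradedPart hcc hw
  rw [zero_add] at hw2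
  refine ⟨monomial m c, fun h => hc (by rwa [monomial_eq_zero] at h), C c⁻¹ • w, hw2, ?_⟩
  have hleib := D.leibniz 1 _ (bigradedPart_le hb) g
  rw [hd, map_smul, LinearMap.smul_apply, D.one_mul hF, pow_one, neg_smul, one_smul, hw',
    map_smul] at hleib
  rw [map_smul, smul_sub, smul_smul, _root_.mul_comm, C_mul_monomial, inv_mul_cancel₀ hc, hleib]
  abel

end DGAStructure

/-- Being a boundary modulo `N` can be checked on the basis elements that occur. -/
theorem exists_sub_d_mem (F : MultigradedFreeResolution.{u, v} I)
    (N : Submodule (MvPolynomial (Fin n) k) F.Total) {i : ℕ} {a : Fin n → ℤ} {g : F.Total}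
    (hg : g ∈ F.part i a)
    (H : ∀ e, g e ≠ 0 → ∃ h ∈ F.part (i + 1) (F.mdeg e), F.basisElem e - F.d h ∈ N) :
    ∃ h ∈ F.part (i + 1) a, g - F.d h ∈ N ∧
      ∀ e', h e' ≠ 0 → ∃ e, g e ≠ 0 ∧ ∀ l, F.mdeg e' l ≤ F.mdeg e l := by
  classical
  choose! h hh hN using H
  -- The bound on the support of this combination is what the induction on total degree later uses.
  refine ⟨∑ e ∈ g.support, g e • h e, ?_, ?_, fun e' he' => ?_⟩
  · exact Submodule.sum_mem _ fun e he => smul_mem_bigradedPart' ((mem_bigradedPart_iff.1 hg).2 e)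
      (hh e (Finsupp.mem_support_iff.1 he))
  · have : g - F.d (∑ e ∈ g.support, g e • h e) =
        ∑ e ∈ g.support, g e • (F.basisElem e - F.d (h e)) := by
      conv_lhs => rw [eq_sum_smul_single g]
      simp_rw [map_sum, map_smul, smul_sub, Finset.sum_sub_distrib]
      rw [← eq_sum_smul_single g]
    rw [this]
    exact Submodule.sum_mem _ fun e he =>
      Submodule.smul_mem _ _ (hN e (Finsupp.mem_support_iff.1 he))
  · rw [Finsupp.finsetSum_apply] at he'
    obtain ⟨e, he, h0⟩ := Finset.exists_ne_zero_of_sum_ne_zero he'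
    have he := Finsupp.mem_support_iff.1 he
    refine ⟨e, he, mdeg_le_of_apply_ne_zero (hh e he) fun h1 => h0 ?_⟩
    rw [Finsupp.smul_apply, h1, smul_zero]

/-! ### Decomposition of basis elements and the degree inequality. -/

namespace DGAStructure

variable {F : MultigradedFreeResolution.{u, v} I}

/-- `F_{a+c}` is contained in the saturation of `F_a * F_c`, up to boundaries. -/
theorem exists_basisElem_sub_d_mem_satProd (D : F.DGAStructure) (hF : F.IsMinimal)
    (hI : IsSquarefreeMonomialIdeal I) (a : ℕ) :
    ∀ (b c : ℕ), b = a + c → ∀ e, F.hdeg e = b →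
      ∃ h ∈ F.part (b + 1) (F.mdeg e), F.basisElem e - F.d h ∈ D.satProd a c := by
  induction a with
  | zero =>
    intro b c hb e he
    refine ⟨0, zero_mem _, ?_⟩
    rw [map_zero, sub_zero]
    have := F.basisElem_mem_hpart e
    rw [he, hb, zero_add] at this
    exact D.mem_satProd_zero hF this
  | succ a ih =>
    intro b c hb e he
    obtain ⟨b, rfl⟩ : ∃ b', b = b' + 1 := ⟨a + c, by omega⟩
    -- Inner induction on total degree, with `a` fixed; `toNat` loses nothing because multidegrees
    -- are nonnegative.
    induction hs : (∑ l, F.mdeg e l).toNat using Nat.strong_induction_on generalizing e with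
    | _ s ihs =>
      subst hs
      have hbe := F.basisElem_mem_part e
      rw [he] at hbe
      have hd := F.d_mem _ _ _ hbe
      obtain ⟨h, hh, hN, hlt⟩ := F.exists_sub_d_mem (D.satProd a c) hd fun e' he' =>
        ih b c (by omega) e' (mem_homologicalPart_iff.1 (bigradedPart_le hd) e' he')
      -- Basis elements of `h` lie below ones occurring in `∂e`, which by minimality have smaller
      -- total degree than `e`; the inner induction therefore handles `h`.
      obtain ⟨h', hh', hN', -⟩ := F.exists_sub_d_mem (D.satProd (a + 1) c) hh fun e' he' => by
        have he2 := mem_homologicalPart_iff.1 (bigradedPart_le hh) e' he'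
        refine ihs _ ?_ e' he2 rfl
        obtain ⟨e'', h1, h2⟩ := hlt e' he'
        have h3 := sum_mdeg_lt_of_mem_maxSmul hd (hF _) h1
        have h4 : ∑ l, F.mdeg e' l ≤ ∑ l, F.mdeg e'' l := Finset.sum_le_sum fun l _ => h2 l
        have h5 : 0 ≤ ∑ l, F.mdeg e' l :=
          Finset.sum_nonneg fun l _ => (D.mdeg_squarefree hF hI _ e' rfl l).1
        omega
      obtain ⟨e₁, he₁, hle⟩ := hF.exists_hdeg_one b e he
      obtain ⟨s, hs, w, hw, hsw⟩ :=
        D.exists_smul_sub_d_eq_mul hF hI he₁ hle (Submodule.sub_mem _ hbe hh)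
      have he₁' := F.basisElem_mem_hpart e₁
      rw [he₁] at he₁'
      -- The outer induction placed `∂(e - h)` in the saturation of `F_a * F_c`; multiplying by `e₁`
      -- raises `a` by one.
      have hw' : F.basisElem e - h - F.d w ∈ D.satProd (a + 1) c := by
        refine D.mem_satProd_of_smul_mem hs ?_
        rw [hsw, map_sub]
        exact D.mul_mem_satProd he₁' hN
      refine ⟨w + h', Submodule.add_mem _ hw hh', ?_⟩
      have : F.basisElem e - F.d (w + h') = (F.basisElem e - h - F.d w) + (h - F.d h') := by
        rw [map_add]
        abel
      rw [this]
      exact Submodule.add_mem _ hw' hN'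

theorem exists_mdeg_le_add (D : F.DGAStructure) (hF : F.IsMinimal)
    (hI : IsSquarefreeMonomialIdeal I) {a c : ℕ} {e : F.B} (he : F.hdeg e = a + c) :
    ∃ e₁ e₂, F.hdeg e₁ = a ∧ F.hdeg e₂ = c ∧ ∀ l, F.mdeg e l ≤ F.mdeg e₁ l + F.mdeg e₂ l := by
  obtain ⟨h, -, p, hp, hmem⟩ := D.exists_basisElem_sub_d_mem_satProd hF hI a _ c rfl e he
  by_contra! H
  -- If no pair satisfies the inequality, the coefficient at `e` vanishes on all products of basis
  -- elements, hence on `F_a * F_c`.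
  have h1 : ∀ e₁, F.hdeg e₁ = a →
      F.hpart c ≤ LinearMap.ker (Finsupp.lapply e ∘ₗ D.mul (F.basisElem e₁)) := by
    refine fun e₁ he₁ => homologicalPart_le fun e₂ he₂ => ?_
    rw [LinearMap.mem_ker]
    by_contra h0
    obtain ⟨l, hl⟩ := H e₁ e₂ he₁ he₂
    have := mdeg_le_of_apply_ne_zero (D.mul_mem _ _ _ _ _ (F.basisElem_mem_part e₁) _
      (F.basisElem_mem_part e₂)) h0 l
    rw [Pi.add_apply] at this
    omega
  have h2 : ∀ g ∈ F.hpart c, F.hpart a ≤ LinearMap.ker (Finsupp.lapply e ∘ₗ D.mul.flip g) :=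
    fun g hg => homologicalPart_le fun e₁ he₁ => h1 e₁ he₁ hg
  have h3 : Submodule.map₂ D.mul (F.hpart a) (F.hpart c) ≤
      LinearMap.ker (Finsupp.lapply e : F.Total →ₗ[MvPolynomial (Fin n) k] _) :=
    Submodule.map₂_le.2 fun f hf g hg => h2 g hg hf
  have h4 : p * (F.basisElem e - F.d h) e = 0 := h3 hmem
  have h5 := (mul_eq_zero.1 h4).resolve_left hp
  rw [Finsupp.sub_apply, Finsupp.single_eq_same] at h5
  -- By minimality `∂h` has zero constant term at `e`, so the coefficient of `e - ∂h` there has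
  -- constant term `1`, a contradiction.
  have h6 := congrArg (coeff 0) h5
  rw [coeff_sub, mem_maxHomogeneousIdeal_smul_top_iff.1 (hF h) e, coeff_zero_one, coeff_zero,
    sub_zero] at h6
  exact one_ne_zero h6

end DGAStructure

end MultigradedFreeResolution

/-- Subadditivity of the maximal shifts. The resolution `F` is the minimal free resolution, with
its DGA structure; the Betti numbers of `S/I`, as dimensions of `Tor`, may be computed from an
arbitrary multigraded free resolution `G` (for instance `G = F`). The first conjunct says that
the maximum that defines `t_i` exists for `0 ≤ i ≤ pdim S/I`. -/
theorem proposition4p4 {k : Type u} [Field k] {n : ℕ} (I : Ideal (MvPolynomial (Fin n) k))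
    (hI : IsSquarefreeMonomialIdeal I)
    (F : MultigradedFreeResolution.{u, v} I) (hF : F.IsMinimal) (hDGA : Nonempty F.DGAStructure)
    (G : MultigradedFreeResolution.{u, w} I) :
    (∀ i : ℕ,
      (i : WithBot ℕ∞) ≤ CategoryTheory.projectiveDimension
        (ModuleCat.of (MvPolynomial (Fin n) k) (MvPolynomial (Fin n) k ⧸ I)) →
      IsGreatest {j : ℤ | G.gradedBetti i j ≠ 0} (G.maxShift i)) ∧
    (∀ a b : ℕ, 1 ≤ a → a < b →
      (b : WithBot ℕ∞) ≤ CategoryTheory.projectiveDimension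
        (ModuleCat.of (MvPolynomial (Fin n) k) (MvPolynomial (Fin n) k ⧸ I)) →
      G.maxShift b ≤ G.maxShift a + G.maxShift (b - a)) := by
  have greatest := fun (i : ℕ) hi =>
    F.isGreatest_maxShift hI hF G (F.exists_basis_of_le_projectiveDimension (i := i) hi)
  refine ⟨greatest, fun a b _ hab hb => ?_⟩
  obtain ⟨D⟩ := hDGA
  -- `t_b` is attained, so it is the total degree of an actual basis element of `F_b`.
  obtain ⟨e, he, hsum⟩ := (F.gradedBetti_ne_zero_iff hI hF G b _).1 (greatest b hb).1
  obtain ⟨e₁, e₂, h1, h2, hle⟩ :=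
    D.exists_mdeg_le_add hF hI (a := a) (c := b - a) (he.trans (by omega))
  rw [← hsum, ← h2, ← h1]
  calc ∑ l, F.mdeg e l ≤ ∑ l, F.mdeg e₁ l + ∑ l, F.mdeg e₂ l := by
        rw [← Finset.sum_add_distrib]
        exact Finset.sum_le_sum fun l _ => hle l
    _ ≤ G.maxShift (F.hdeg e₁) + G.maxShift (F.hdeg e₂) :=
        add_le_add (F.sum_mdeg_le_maxShift hI hF G e₁) (F.sum_mdeg_le_maxShift hI hF G e₂)
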